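/- Let $N\ge 1$ and $0\le K\le N$. Let $\mathcal H$ be the Hecke algebra of $S_N$ over $\mathbb Z[t,t^{-1}]$, with generators $T_1,\dots,T_{N-1}$, the quadratic relations $(T_i-t)(T_i+t^{-1})=0$, the braid relations and the commutation relations; its bar involution is the ring automorphism with $\overline{T_i}=T_i^{-1}$, $\overline t=t^{-1}$. Let $\mathcal M^-$ be the free $\mathbb Z[t,t^{-1}]$-module with basis $(m_x)$ indexed by the left cosets $x\in S_N/(S_K\times S_{N-K})$. Write $|v|$ for the number of inversions of $v\in S_N$ and $|x|=\min_{v\in x}|v|$. The algebra $\mathcal H$ acts on $\mathcal M^-$ by $T_i m_x=-t^{-1}m_x$ if $s_ix=x$, $T_im_x=m_{s_ix}$ if $|s_ix|>|x|$, and $T_im_x=(t-t^{-1})m_x+m_{s_ix}$ if $|s_ix|<|x|$. Let $\varphi^-:\mathcal H\to\mathcal M^-$, $\varphi^-(h)=h\,m_e$, where $e$ is the coset of the identity (so $\varphi^-(T_v)=(-t^{-1})^{|v|-|x|}m_x$ for $v\in x$). There is a unique map $m\mapsto\overline m$ on $\mathcal M^-$ with $\overline{\varphi^-(h)}=\varphi^-(\overline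 h)$ for all $h\in\mathcal H$, and there is a unique basis $(C^-_y)$ of $\mathcal M^-$ with $\overline{C^-_y}=C^-_y$ and $C^-_y=\sum_{x\le y}P^-_{x,y}(t^{-1})\,m_x$, where $P^-_{x,x}=1$ and $P^-_{x,y}(t^{-1})\in t^{-1}\mathbb Z[t^{-1}]$ for $x<y$; here $x\le y$ iff $v\le w$ in the Bruhat order for some $v\in x$, $w\in y$. Cosets are identified with binary strings with $K$ letters $1$ and $N-K$ letters $2$, the coset of $v$ being sent to the string whose $i$-th letter is $1$ iff $v^{-1}(i)\le K$; strings are identified with lattice paths starting at $(0,0)$, the letter $1$ being the step $(1,-1)$ and the letter $2$ the step $(1,1)$. Write $\alpha\le\beta$ if the path $\alpha$ is weakly below $\beta$. A Dyck strip is the set of unit boxes (rotated by $45^\circ$) centered at the vertices of a lattice path with steps $(1,\pm1)$ from some $(x,y)$ to $(x+2l,y)$, $l\ge 0$, that does not go below height $y$. For $\alpha\le\beta$ let $\mathrm{Conf}^{II}(\alpha,\beta)$ be the set of all tilings $\mathcal D$ of the region between $\alpha$ and $\beta$ by non-overlapping Dyck strips such that for every ordered pair $(D,D')$ of distinct strips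 of $\mathcal D$: if some box of $D'$ is just above (translated by $(0,2)$), NW (translated by $(-1,1)$) or NE (translated by $(1,1)$) of a box of $D$, then all boxes just above, NW and NE of a box of $D$ belong to $D$ or $D'$. Put $$Q^{II,-}_{\alpha,\beta}(t^{-1})=\sum_{\mathcal D\in\mathrm{Conf}^{II}(\alpha,\beta)}t^{-|\mathcal D|}\quad(\alpha<\beta),\qquad Q^{II,-}_{\alpha,\alpha}=1,\qquad Q^{II,-}_{\alpha,\beta}=0\quad(\alpha\not\le\beta).$$ The link pattern of $\beta$ pairs the steps $i<j$ whose midpoints have equal height and are such that the open horizontal segment between these midpoints stays strictly below the path $\beta$; then $\beta_i=2$ and $\beta_j=1$. Let $\mathcal F(\beta)$ be the set of paths $\alpha\le\beta$ obtained from $\beta$ by flipping some (possibly none) of its pairings, i.e. replacing the letters $2,1$ at the two ends of such a pairing by $1,2$. Let $d(\alpha,\beta)=\tfrac12\,\#\{i:\alpha_i\ne\beta_i\}$. **Theorem.** For all such paths $\alpha,\beta$, $$P^-_{\alpha,\beta}(t^{-1})=Q^{II,-}_{\alpha,\beta}(t^{-1})=\begin{cases}t^{-d(\alpha,\beta)}&\text{if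 }\alpha\in\mathcal F(\beta),\\ 0&\text{otherwise.}\end{cases}$$ -/

import Mathlib

open LaurentPolynomial

noncomputable section

namespace ParabolicKL

/-! ### The symmetric group: length, Bruhat order, maximal parabolic cosets -/

/-- The position `i` (counted from `0`) of the `i`-th of the `N - 1` adjacent pairs `(i, i+1)`. -/
def lo {N : ℕ} (i : Fin (N - 1)) : Fin N := ⟨i.1, by omega⟩

/-- The position `i + 1` of the `i`-th adjacent pair `(i, i+1)`. -/
def hi {N : ℕ} (i : Fin (N - 1)) : Fin N := ⟨i.1 + 1, by omega⟩

/-- The adjacent transposition exchanging `i` and `i + 1`. -/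
def adj {N : ℕ} (i : Fin (N - 1)) : Equiv.Perm (Fin N) := Equiv.swap (lo i) (hi i)

/-- The set of inversions of a permutation. -/
def inversions {N : ℕ} (v : Equiv.Perm (Fin N)) : Finset (Fin N × Fin N) :=
  Finset.univ.filter fun p => p.1 < p.2 ∧ v p.2 < v p.1

lemma mem_inversions {N : ℕ} (v : Equiv.Perm (Fin N)) (a b : Fin N) :
    (a, b) ∈ inversions v ↔ a < b ∧ v b < v a := by
  simp [inversions]

lemma perm_inv_apply {N : ℕ} (v : Equiv.Perm (Fin N)) (i : Fin N) : v⁻¹ (v i) = i :=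
  v.symm_apply_apply i

lemma perm_apply_inv {N : ℕ} (v : Equiv.Perm (Fin N)) (i : Fin N) : v (v⁻¹ i) = i :=
  v.apply_symm_apply i

/-- The length of a permutation, i.e. its number of inversions. -/
def length {N : ℕ} (v : Equiv.Perm (Fin N)) : ℕ := (inversions v).card

/-- The (strong) Bruhat order on permutations: the reflexive transitive closure of the
length-increasing multiplications by a transposition. -/
def BruhatLE {N : ℕ} : Equiv.Perm (Fin N) → Equiv.Perm (Fin N) → Prop :=
  Relation.ReflTransGen fun v w =>
    (∃ i j : Fin N, i ≠ j ∧ w = v * Equiv.swap i j) ∧ length v < length w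

/-- The subgroup `S_K × S_{N-K}` of `S_N`: the permutations that preserve the set of the first
`K` letters (hence also the set of the last `N - K` letters). -/
def parabolic (N K : ℕ) : Subgroup (Equiv.Perm (Fin N)) where
  carrier := {v | ∀ i, (v i).1 < K ↔ i.1 < K}
  one_mem' := fun _ => Iff.rfl
  mul_mem' := fun {a b} ha hb i => (ha (b i)).trans (hb i)
  inv_mem' := fun {a} ha i => by
    have h := ha (a⁻¹ i)
    rw [perm_apply_inv] at h
    exact h.symm

/-- The left cosets `v (S_K × S_{N-K})`. -/
abbrev Coset (N K : ℕ) : Type := Equiv.Perm (Fin N) ⧸ parabolic N K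

/-- The coset of the identity. -/
def idCoset (N K : ℕ) : Coset N K := ((1 : Equiv.Perm (Fin N)) : Coset N K)

/-- The length of a coset: the minimum of the lengths of its elements. -/
def cosetLength {N K : ℕ} (x : Coset N K) : ℕ :=
  sInf {l | ∃ v : Equiv.Perm (Fin N), (v : Coset N K) = x ∧ length v = l}

/-- The order on cosets induced by the Bruhat order. -/
def CosetLE {N K : ℕ} (x y : Coset N K) : Prop :=
  ∃ v w : Equiv.Perm (Fin N), (v : Coset N K) = x ∧ (w : Coset N K) = y ∧ BruhatLE v w

/-! ### The Hecke algebra and its bar involution -/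

/-- The base ring `ℤ[t, t⁻¹]`; the power `t ^ n` is `T n`. -/
abbrev R : Type := LaurentPolynomial ℤ

/-- The defining relations of the Hecke algebra. -/
inductive HeckeRel (N : ℕ) :
    FreeAlgebra R (Fin (N - 1)) → FreeAlgebra R (Fin (N - 1)) → Prop
  | quadratic (i : Fin (N - 1)) :
      HeckeRel N ((FreeAlgebra.ι R i - algebraMap R _ (T 1)) *
        (FreeAlgebra.ι R i + algebraMap R _ (T (-1)))) 0
  | braid (i j : Fin (N - 1)) (h : i.1 + 1 = j.1) :
      HeckeRel N (FreeAlgebra.ι R i * FreeAlgebra.ι R j * FreeAlgebra.ι R i)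
        (FreeAlgebra.ι R j * FreeAlgebra.ι R i * FreeAlgebra.ι R j)
  | comm (i j : Fin (N - 1)) (h : i.1 + 1 < j.1) :
      HeckeRel N (FreeAlgebra.ι R i * FreeAlgebra.ι R j)
        (FreeAlgebra.ι R j * FreeAlgebra.ι R i)

/-- The Hecke algebra of `S_N` over `ℤ[t, t⁻¹]`. -/
def Hecke (N : ℕ) : Type := RingQuot (HeckeRel N)

instance (N : ℕ) : Semiring (Hecke N) := inferInstanceAs (Semiring (RingQuot (HeckeRel N)))

instance (N : ℕ) : Algebra R (Hecke N) := inferInstanceAs (Algebra R (RingQuot (HeckeRel N)))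

instance (N : ℕ) : Ring (Hecke N) := Algebra.semiringToRing R

/-- The projection from the free algebra. -/
def proj (N : ℕ) : FreeAlgebra R (Fin (N - 1)) →ₐ[R] Hecke N := RingQuot.mkAlgHom R (HeckeRel N)

lemma proj_rel {N : ℕ} {a b : FreeAlgebra R (Fin (N - 1))} (h : HeckeRel N a b) :
    proj N a = proj N b := RingQuot.mkAlgHom_rel R h

/-- The universal property of the Hecke algebra. -/
def heckeLift {N : ℕ} {A : Type} [Ring A] [Algebra R A] (f : FreeAlgebra R (Fin (N - 1)) →ₐ[R] A)
    (hf : ∀ ⦃a b⦄, HeckeRel N a b → f a = f b) : Hecke N →ₐ[R] A :=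
  RingQuot.liftAlgHom R ⟨f, hf⟩

lemma heckeLift_proj {N : ℕ} {A : Type} [Ring A] [Algebra R A]
    (f : FreeAlgebra R (Fin (N - 1)) →ₐ[R] A)
    (hf : ∀ ⦃a b⦄, HeckeRel N a b → f a = f b) (x : FreeAlgebra R (Fin (N - 1))) :
    heckeLift f hf (proj N x) = f x :=
  RingQuot.liftAlgHom_mkAlgHom_apply R f hf x

/-- The generators `T_i` of the Hecke algebra. -/
def gen {N : ℕ} (i : Fin (N - 1)) : Hecke N := proj N (FreeAlgebra.ι R i)

/-- The inverse of the generator `T_i`, namely `T_i - (t - t⁻¹)`. -/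
def genInv {N : ℕ} (i : Fin (N - 1)) : Hecke N := gen i - algebraMap R (Hecke N) (T 1 - T (-1))

lemma T_mul_T_neg : (T 1 : R) * T (-1) = 1 := by
  rw [← T_add]; simp

lemma gen_quadratic {N : ℕ} (i : Fin (N - 1)) :
    (gen i - algebraMap R (Hecke N) (T 1)) * (gen i + algebraMap R (Hecke N) (T (-1))) = 0 := by
  have h := proj_rel (HeckeRel.quadratic (N := N) i)
  rw [map_mul, map_sub, map_add, AlgHom.commutes, AlgHom.commutes, map_zero] at h
  exact h

lemma gen_braid {N : ℕ} (i j : Fin (N - 1)) (h : i.1 + 1 = j.1) :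
    (gen i * gen j * gen i : Hecke N) = gen j * gen i * gen j := by
  have h := proj_rel (HeckeRel.braid (N := N) i j h)
  simp only [map_mul] at h
  exact h

lemma gen_comm {N : ℕ} (i j : Fin (N - 1)) (h : i.1 + 1 < j.1) :
    (gen i * gen j : Hecke N) = gen j * gen i := by
  have h := proj_rel (HeckeRel.comm (N := N) i j h)
  simp only [map_mul] at h
  exact h

lemma gen_sq {N : ℕ} (i : Fin (N - 1)) :
    (gen i * gen i : Hecke N) = gen i * algebraMap R (Hecke N) (T 1 - T (-1)) + 1 := by
  have h := gen_quadratic i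
  have hc := Algebra.commutes (R := R) (A := Hecke N) (T 1) (gen i)
  have h1 : algebraMap R (Hecke N) (T 1) * algebraMap R (Hecke N) (T (-1)) = 1 := by
    rw [← map_mul, T_mul_T_neg, map_one]
  rw [sub_mul, mul_add, mul_add, h1, hc] at h
  rw [map_sub, mul_sub, ← sub_eq_zero, ← h]
  abel

lemma gen_mul_genInv {N : ℕ} (i : Fin (N - 1)) : (gen i * genInv i : Hecke N) = 1 := by
  rw [genInv, mul_sub, gen_sq]; abel

lemma genInv_mul_gen {N : ℕ} (i : Fin (N - 1)) : (genInv i * gen i : Hecke N) = 1 := by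
  rw [genInv, sub_mul, gen_sq, Algebra.commutes]; abel

/-- The generator `T_i` as a unit of the Hecke algebra. -/
def genUnit {N : ℕ} (i : Fin (N - 1)) : (Hecke N)ˣ :=
  ⟨gen i, genInv i, gen_mul_genInv i, genInv_mul_gen i⟩

/-- The Hecke algebra with scalars acting through `t ↦ t⁻¹`. -/
def HeckeTwist (N : ℕ) : Type := Hecke N

instance (N : ℕ) : Ring (HeckeTwist N) := inferInstanceAs (Ring (Hecke N))

instance (N : ℕ) : Algebra R (HeckeTwist N) :=
  RingHom.toAlgebra' ((algebraMap R (Hecke N)).comp (invert (R := ℤ)).toRingEquiv.toRingHom)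
    (fun c x => Algebra.commutes (A := Hecke N) (invert c) x)

lemma algebraMap_twist (N : ℕ) (r : R) :
    algebraMap R (HeckeTwist N) r = algebraMap R (Hecke N) (invert r) := rfl

/-- `T_i ↦ T_i⁻¹` on the free algebra, semilinear for `t ↦ t⁻¹`. -/
def barFree (N : ℕ) : FreeAlgebra R (Fin (N - 1)) →ₐ[R] HeckeTwist N :=
  FreeAlgebra.lift R (fun i => (genInv i : Hecke N))

lemma barFree_ι {N : ℕ} (i : Fin (N - 1)) :
    barFree N (FreeAlgebra.ι R i) = (genInv i : Hecke N) := by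
  exact FreeAlgebra.lift_ι_apply _ _

lemma barFree_rel {N : ℕ} {a b : FreeAlgebra R (Fin (N - 1))} (h : HeckeRel N a b) :
    barFree N a = barFree N b := by
  cases h with
  | quadratic i =>
    rw [map_mul, map_sub, map_add, AlgHom.commutes, AlgHom.commutes, barFree_ι, map_zero,
      algebraMap_twist, algebraMap_twist, invert_T, invert_T]
    change (genInv i - algebraMap R (Hecke N) (T (-1))) *
      (genInv i + algebraMap R (Hecke N) (T (- -1))) = 0
    rw [neg_neg, genInv, ← gen_quadratic i, map_sub]
    congr 1 <;> abel
  | braid i j h =>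
    simp only [map_mul, barFree_ι]
    have := congrArg (fun u : (Hecke N)ˣ => ((u⁻¹ : (Hecke N)ˣ) : Hecke N))
      (show genUnit i * genUnit j * genUnit i = genUnit j * genUnit i * genUnit j from
        Units.ext (gen_braid i j h))
    simp only [mul_inv_rev, Units.val_mul] at this
    rw [← mul_assoc, ← mul_assoc] at this
    exact this
  | comm i j h =>
    simp only [map_mul, barFree_ι]
    have := congrArg (fun u : (Hecke N)ˣ => ((u⁻¹ : (Hecke N)ˣ) : Hecke N))
      (show genUnit i * genUnit j = genUnit j * genUnit i from Units.ext (gen_comm i j h))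
    simp only [mul_inv_rev, Units.val_mul] at this
    exact this.symm

/-- The bar involution of the Hecke algebra: the ring homomorphism with `T_i ↦ T_i⁻¹` and
`t ↦ t⁻¹`. -/
def bar (N : ℕ) : Hecke N →+* Hecke N :=
  (heckeLift (barFree N) (fun _ _ h => barFree_rel h)).toRingHom

lemma bar_gen {N : ℕ} (i : Fin (N - 1)) : bar N (gen i) = genInv i :=
  (heckeLift_proj (barFree N) (fun _ _ h => barFree_rel h) (FreeAlgebra.ι R i)).trans (barFree_ι i)

lemma bar_algebraMap {N : ℕ} (r : R) :
    bar N (algebraMap R (Hecke N) r) = algebraMap R (Hecke N) (invert r) :=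
  (heckeLift (barFree N) (fun _ _ h => barFree_rel h)).commutes r

/-! ### Paths -/

/-- Binary strings with `K` letters `1` and `N - K` letters `2`, read as lattice paths:
`false` is the letter `1` and the down step `(1, -1)`,
`true` is the letter `2` and the up step `(1, 1)`. -/
abbrev Path (N K : ℕ) : Type :=
  {α : Fin N → Bool // (Finset.univ.filter fun i => α i = false).card = K}

/-- The letters of the binary string of `v`: the action of `v` on `1…12…2` (with `K` letters `1`). -/
def word {N : ℕ} (K : ℕ) (v : Equiv.Perm (Fin N)) : Fin N → Bool :=
  fun i => decide (K ≤ (v⁻¹ i).1)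

lemma word_eq_iff {N K : ℕ} (v w : Equiv.Perm (Fin N)) :
    word K v = word K w ↔ v⁻¹ * w ∈ parabolic N K := by
  constructor
  · intro h i
    have := congrFun h (w i)
    simp only [word, perm_inv_apply, decide_eq_decide] at this
    rw [Equiv.Perm.mul_apply]
    omega
  · intro h
    funext i
    have := h (w⁻¹ i)
    rw [Equiv.Perm.mul_apply, perm_apply_inv] at this
    simp only [word, decide_eq_decide]
    omega

/-- The binary string of a coset. -/
def cosetWord {N K : ℕ} (x : Coset N K) : Fin N → Bool :=
  Quotient.liftOn' x (word K) fun v w h => by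
    rw [word_eq_iff]; exact QuotientGroup.leftRel_apply.mp h

lemma cosetWord_mk {N K : ℕ} (v : Equiv.Perm (Fin N)) : cosetWord (v : Coset N K) = word K v := rfl

lemma cosetWord_injective {N K : ℕ} : Function.Injective (cosetWord (N := N) (K := K)) := by
  intro x y h
  induction x using QuotientGroup.induction_on with | _ v
  induction y using QuotientGroup.induction_on with | _ w
  rw [cosetWord_mk, cosetWord_mk, word_eq_iff] at h
  exact QuotientGroup.eq.mpr h

lemma card_cosetWord {N K : ℕ} (hK : K ≤ N) (x : Coset N K) :
    (Finset.univ.filter fun i => cosetWord x i = false).card = K := by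
  induction x using QuotientGroup.induction_on with | _ v
  have : (Finset.univ.filter fun i => cosetWord (v : Coset N K) i = false)
      = (Finset.univ.filter fun i : Fin N => i.1 < K).map v.toEmbedding := by
    ext i
    simp [cosetWord_mk, word, Finset.mem_map_equiv]
  rw [this, Finset.card_map, Fin.card_filter_val_lt]
  exact min_eq_right hK

/-- The path of a coset. -/
def pathOf {N K : ℕ} (hK : K ≤ N) (x : Coset N K) : Path N K :=
  ⟨cosetWord x, card_cosetWord hK x⟩

lemma pathOf_bijective {N K : ℕ} (hK : K ≤ N) : Function.Bijective (pathOf (K := K) hK) := by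
  constructor
  · intro x y h
    exact cosetWord_injective (congrArg Subtype.val h)
  · rintro ⟨f, hf⟩
    have hc : Fintype.card {i : Fin N // i.1 < K} = Fintype.card {i : Fin N // f i = false} := by
      rw [Fintype.card_subtype, Fintype.card_subtype, hf, Fin.card_filter_val_lt]
      exact min_eq_right hK
    let e := Fintype.equivOfCardEq hc
    refine ⟨((e.extendSubtype : Equiv.Perm (Fin N)) : Coset N K), Subtype.ext (funext fun i => ?_)⟩
    change word K e.extendSubtype i = f i
    obtain ⟨j, rfl⟩ := e.extendSubtype.surjective i
    simp only [word, perm_inv_apply]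
    by_cases hj : j.1 < K
    · have := e.extendSubtype_mem j hj
      simp [this, hj]
    · have := e.extendSubtype_not_mem j hj
      simp only [Bool.not_eq_false] at this
      simp [this, not_lt.mp hj]

/-- The bijection between cosets and paths. -/
def pathEquiv {N K : ℕ} (hK : K ≤ N) : Coset N K ≃ Path N K :=
  Equiv.ofBijective (pathOf hK) (pathOf_bijective hK)

/-! ### The Hecke module -/

/-- The free module with basis `m_x` indexed by the cosets. -/
abbrev M (N K : ℕ) : Type := Coset N K →₀ R

/-- The basis element `m_x`. -/
def m {N K : ℕ} (x : Coset N K) : M N K := Finsupp.single x 1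

open Classical in
/-- The value of `T_i` on the basis element `m_x`, for the sign `-`. -/
def opBasis {N K : ℕ} (i : Fin (N - 1)) (x : Coset N K) : M N K :=
  if adj i • x = x then (-T (-1) : R) • m x
  else if cosetLength x < cosetLength (adj i • x) then m (adj i • x)
  else (T 1 - T (-1) : R) • m x + m (adj i • x)

/-- The operator `T_i` on the module. -/
def op {N K : ℕ} (i : Fin (N - 1)) : Module.End R (M N K) :=
  Finsupp.linearCombination R (opBasis i)

lemma op_m {N K : ℕ} (i : Fin (N - 1)) (x : Coset N K) : op i (m x) = opBasis i x := by
  simp [op, m]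

lemma lo_ne_hi {N : ℕ} (i : Fin (N - 1)) : lo i ≠ hi i := by
  simp [lo, hi]

lemma cosetWord_smul {N K : ℕ} (v : Equiv.Perm (Fin N)) (x : Coset N K) (k : Fin N) :
    cosetWord (v • x) k = cosetWord x (v⁻¹ k) := by
  induction x using QuotientGroup.induction_on with | _ w
  change word K (v * w) k = word K w (v⁻¹ k)
  simp [word, mul_inv_rev]

lemma adj_inv {N : ℕ} (i : Fin (N - 1)) : (adj i)⁻¹ = adj i := Equiv.swap_inv _ _

lemma inversions_adj_mul {N : ℕ} (i : Fin (N - 1)) (w : Equiv.Perm (Fin N)) {a b : Fin N}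
    (h : (a, b) ∈ inversions (adj i * w)) :
    (a, b) ∈ inversions w ∨ (w a = lo i ∧ w b = hi i) := by
  rw [mem_inversions, Equiv.Perm.mul_apply, Equiv.Perm.mul_apply, Fin.lt_def, Fin.lt_def] at h
  rw [mem_inversions, Fin.lt_def, Fin.lt_def]
  obtain ⟨h1, h2⟩ := h
  have hne : (w a).1 ≠ (w b).1 := fun e => h1.ne (congrArg Fin.val (w.injective (Fin.ext e)))
  simp only [adj, Equiv.swap_apply_def, Fin.ext_iff] at h2 ⊢
  split_ifs at h2 <;> simp only [lo, hi] at * <;> omega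

lemma length_adj_mul_lt {N : ℕ} (i : Fin (N - 1)) (w : Equiv.Perm (Fin N))
    (h : w⁻¹ (hi i) < w⁻¹ (lo i)) : length (adj i * w) < length w := by
  apply Finset.card_lt_card
  rw [Finset.ssubset_iff_of_subset]
  · refine ⟨(w⁻¹ (hi i), w⁻¹ (lo i)), ?_, ?_⟩
    · rw [mem_inversions, perm_apply_inv, perm_apply_inv]
      exact ⟨h, by simp [lo, hi]⟩
    · rw [mem_inversions, Equiv.Perm.mul_apply, Equiv.Perm.mul_apply, perm_apply_inv,
        perm_apply_inv, adj, Equiv.swap_apply_left, Equiv.swap_apply_right]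
      simp [lo, hi]
  · intro p hab
    obtain ⟨a, b⟩ := p
    rcases inversions_adj_mul i w hab with h' | ⟨ha, hb⟩
    · exact h'
    · rw [← ha, ← hb, perm_inv_apply, perm_inv_apply] at h
      exact absurd h ((mem_inversions _ _ _).mp hab).1.asymm

lemma cosetLength_le {N K : ℕ} (v : Equiv.Perm (Fin N)) :
    cosetLength (v : Coset N K) ≤ length v :=
  Nat.sInf_le ⟨v, rfl, rfl⟩

lemma exists_cosetLength {N K : ℕ} (x : Coset N K) :
    ∃ v : Equiv.Perm (Fin N), (v : Coset N K) = x ∧ length v = cosetLength x := by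
  have : {l | ∃ v : Equiv.Perm (Fin N), (v : Coset N K) = x ∧ length v = l}.Nonempty := by
    induction x using QuotientGroup.induction_on with | _ v
    exact ⟨_, v, rfl, rfl⟩
  exact Nat.sInf_mem this

lemma adj_smul_adj_smul {N K : ℕ} (i : Fin (N - 1)) (x : Coset N K) :
    adj i • adj i • x = x := by
  rw [smul_smul, adj, Equiv.swap_mul_self, one_smul]

lemma cosetLength_lt {N K : ℕ} (i : Fin (N - 1)) (x : Coset N K)
    (h0 : cosetWord x (lo i) = false) (h1 : cosetWord x (hi i) = true) :
    cosetLength x < cosetLength (adj i • x) := by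
  obtain ⟨w, hw, hl⟩ := exists_cosetLength (adj i • x)
  have hx : ((adj i * w : Equiv.Perm (Fin N)) : Coset N K) = x := by
    rw [← adj_smul_adj_smul i x, ← hw]; rfl
  rw [← hx] at h0 h1
  simp only [cosetWord_mk, word, mul_inv_rev, Equiv.Perm.mul_apply, adj_inv] at h0 h1
  have e0 : adj i (lo i) = hi i := Equiv.swap_apply_left _ _
  have e1 : adj i (hi i) = lo i := Equiv.swap_apply_right _ _
  rw [e0] at h0
  rw [e1] at h1
  simp only [decide_eq_false_iff_not, decide_eq_true_eq] at h0 h1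
  calc cosetLength x = cosetLength ((adj i * w : Equiv.Perm (Fin N)) : Coset N K) := by rw [hx]
    _ ≤ length (adj i * w) := cosetLength_le _
    _ < length w := length_adj_mul_lt i w (by rw [Fin.lt_def]; omega)
    _ = _ := hl

lemma adj_smul_eq {N K : ℕ} (i : Fin (N - 1)) (x : Coset N K)
    (h : cosetWord x (lo i) = cosetWord x (hi i)) : adj i • x = x := by
  apply cosetWord_injective
  funext k
  rw [cosetWord_smul, adj_inv, adj, Equiv.swap_apply_def]
  split_ifs with h1 h2
  · rw [h1, h]
  · rw [h2, h]
  · rfl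

lemma adj_smul_ne {N K : ℕ} (i : Fin (N - 1)) (x : Coset N K)
    (h : cosetWord x (lo i) ≠ cosetWord x (hi i)) : adj i • x ≠ x := by
  intro e
  apply h
  have := cosetWord_smul (adj i) x (hi i)
  rw [e, adj_inv, adj, Equiv.swap_apply_right] at this
  exact this.symm

lemma op_same {N K : ℕ} (i : Fin (N - 1)) (x : Coset N K)
    (h : cosetWord x (lo i) = cosetWord x (hi i)) : op i (m x) = (-T (-1) : R) • m x := by
  rw [op_m, opBasis, if_pos (adj_smul_eq i x h)]

lemma op_up {N K : ℕ} (i : Fin (N - 1)) (x : Coset N K)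
    (h0 : cosetWord x (lo i) = false) (h1 : cosetWord x (hi i) = true) :
    op i (m x) = m (adj i • x) := by
  rw [op_m, opBasis, if_neg (adj_smul_ne i x (by simp [h0, h1])), if_pos (cosetLength_lt i x h0 h1)]

lemma op_down {N K : ℕ} (i : Fin (N - 1)) (x : Coset N K)
    (h0 : cosetWord x (lo i) = true) (h1 : cosetWord x (hi i) = false) :
    op i (m x) = (T 1 - T (-1) : R) • m x + m (adj i • x) := by
  have := cosetLength_lt i (adj i • x)
    (by rw [cosetWord_smul, adj_inv, adj, Equiv.swap_apply_left, h1])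
    (by rw [cosetWord_smul, adj_inv, adj, Equiv.swap_apply_right, h0])
  rw [adj_smul_adj_smul] at this
  rw [op_m, opBasis, if_neg (adj_smul_ne i x (by simp [h0, h1])), if_neg this.asymm]

lemma cosetWord_adj_lo {N K : ℕ} (i : Fin (N - 1)) (x : Coset N K) :
    cosetWord (adj i • x) (lo i) = cosetWord x (hi i) := by
  rw [cosetWord_smul, adj_inv, adj, Equiv.swap_apply_left]

lemma cosetWord_adj_hi {N K : ℕ} (i : Fin (N - 1)) (x : Coset N K) :
    cosetWord (adj i • x) (hi i) = cosetWord x (lo i) := by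
  rw [cosetWord_smul, adj_inv, adj, Equiv.swap_apply_right]

lemma cosetWord_adj_of_ne {N K : ℕ} (i : Fin (N - 1)) (x : Coset N K) (k : Fin N)
    (h0 : k ≠ lo i) (h1 : k ≠ hi i) : cosetWord (adj i • x) k = cosetWord x k := by
  rw [cosetWord_smul, adj_inv, adj, Equiv.swap_apply_of_ne_of_ne h0 h1]

lemma end_ext {N K : ℕ} {f g : Module.End R (M N K)} (h : ∀ x, f (m x) = g (m x)) : f = g :=
  Finsupp.lhom_ext' fun x => LinearMap.ext_ring (h x)

lemma op_quadratic {N K : ℕ} (i : Fin (N - 1)) :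
    (op i - algebraMap R (Module.End R (M N K)) (T 1)) *
      (op i + algebraMap R (Module.End R (M N K)) (T (-1))) = 0 := by
  apply end_ext
  intro x
  simp only [Module.End.mul_apply, LinearMap.add_apply, LinearMap.sub_apply, map_add, map_smul,
    Module.algebraMap_end_apply, LinearMap.zero_apply]
  cases h0 : cosetWord x (lo i) <;> cases h1 : cosetWord x (hi i)
  · simp only [op_same i x (h0.trans h1.symm), map_smul]
    module
  · rw [op_up i x h0 h1, op_down i (adj i • x) (by rw [cosetWord_adj_lo, h1])
      (by rw [cosetWord_adj_hi, h0]), adj_smul_adj_smul]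
    match_scalars
    · ring
    · linear_combination - T_mul_T_neg
  · rw [op_down i x h0 h1, map_add, map_smul, op_down i x h0 h1,
      op_up i (adj i • x) (by rw [cosetWord_adj_lo, h1])
      (by rw [cosetWord_adj_hi, h0]), adj_smul_adj_smul]
    match_scalars
    · linear_combination - T_mul_T_neg
    · ring
  · simp only [op_same i x (h0.trans h1.symm), map_smul]
    module

lemma op_braid {N K : ℕ} (i j : Fin (N - 1)) (h : i.1 + 1 = j.1) :
    (op i * op j * op i : Module.End R (M N K)) = op j * op i * op j := by
  apply end_ext
  intro x
  simp only [Module.End.mul_apply]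
  have hij : lo j = hi i := Fin.ext h.symm
  have hca : hi j ≠ lo i := fun e => by simp only [hi, lo, Fin.ext_iff] at e; omega
  have hcb : hi j ≠ hi i := fun e => by simp only [hi, Fin.ext_iff] at e; omega
  have hac : lo i ≠ lo j := fun e => by simp only [lo, Fin.ext_iff] at e; omega
  have w1 : ∀ y : Coset N K, cosetWord (adj i • y) (lo i) = cosetWord y (hi i) :=
    cosetWord_adj_lo i
  have w2 : ∀ y : Coset N K, cosetWord (adj i • y) (hi i) = cosetWord y (lo i) :=
    cosetWord_adj_hi i
  have w3 : ∀ y : Coset N K, cosetWord (adj i • y) (hi j) = cosetWord y (hi j) :=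
    fun y => cosetWord_adj_of_ne i y _ hca hcb
  have w4 : ∀ y : Coset N K, cosetWord (adj j • y) (hi i) = cosetWord y (hi j) :=
    fun y => hij ▸ cosetWord_adj_lo j y
  have w5 : ∀ y : Coset N K, cosetWord (adj j • y) (hi j) = cosetWord y (hi i) :=
    fun y => hij ▸ cosetWord_adj_hi j y
  have w6 : ∀ y : Coset N K, cosetWord (adj j • y) (lo i) = cosetWord y (lo i) :=
    fun y => cosetWord_adj_of_ne j y _ hac hca.symm
  have p1 := op_same (N := N) (K := K) i
  have p2 := op_up (N := N) (K := K) i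
  have p3 := op_down (N := N) (K := K) i
  have q1 := op_same (N := N) (K := K) j
  have q2 := op_up (N := N) (K := K) j
  have q3 := op_down (N := N) (K := K) j
  have r1 := adj_smul_adj_smul (N := N) (K := K) i
  have r2 := adj_smul_adj_smul (N := N) (K := K) j
  rw [hij] at q1 q2 q3
  have huv := T_mul_T_neg
  cases h0 : cosetWord x (lo i) <;> cases h1 : cosetWord x (hi i) <;>
    cases h2 : cosetWord x (hi j) <;>
  simp only [p1, p2, p3, q1, q2, q3, w1, w2, w3, w4, w5, w6, h0, h1, h2, map_add, map_smul, r1, r2]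
  · module
  · match_scalars
    · linear_combination (T (-1) - T 1 : R) * huv
    · ring
    · ring
  · module
  · match_scalars
    · linear_combination (T 1 - T (-1) : R) * huv
    · ring
    · ring

lemma op_comm {N K : ℕ} (i j : Fin (N - 1)) (h : i.1 + 1 < j.1) :
    (op i * op j : Module.End R (M N K)) = op j * op i := by
  apply end_ext
  intro x
  simp only [Module.End.mul_apply]
  have hac : lo i ≠ lo j := fun e => by simp only [lo, Fin.ext_iff] at e; omega
  have had : lo i ≠ hi j := fun e => by simp only [lo, hi, Fin.ext_iff] at e; omega
  have hbc : hi i ≠ lo j := fun e => by simp only [lo, hi, Fin.ext_iff] at e; omega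
  have hbd : hi i ≠ hi j := fun e => by simp only [hi, Fin.ext_iff] at e; omega
  have w3 : ∀ y : Coset N K, cosetWord (adj i • y) (lo j) = cosetWord y (lo j) :=
    fun y => cosetWord_adj_of_ne i y _ hac.symm hbc.symm
  have w4 : ∀ y : Coset N K, cosetWord (adj i • y) (hi j) = cosetWord y (hi j) :=
    fun y => cosetWord_adj_of_ne i y _ had.symm hbd.symm
  have w5 : ∀ y : Coset N K, cosetWord (adj j • y) (lo i) = cosetWord y (lo i) :=
    fun y => cosetWord_adj_of_ne j y _ hac had
  have w6 : ∀ y : Coset N K, cosetWord (adj j • y) (hi i) = cosetWord y (hi i) :=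
    fun y => cosetWord_adj_of_ne j y _ hbc hbd
  have p1 := op_same (N := N) (K := K) i
  have p2 := op_up (N := N) (K := K) i
  have p3 := op_down (N := N) (K := K) i
  have q1 := op_same (N := N) (K := K) j
  have q2 := op_up (N := N) (K := K) j
  have q3 := op_down (N := N) (K := K) j
  have e : ∀ y : Coset N K, adj i • adj j • y = adj j • adj i • y := by
    intro y
    apply cosetWord_injective
    funext k
    simp only [cosetWord_smul, adj_inv]
    congr 1
    simp only [adj, Equiv.swap_apply_def]
    split_ifs <;> simp_all
  cases h0 : cosetWord x (lo i) <;> cases h1 : cosetWord x (hi i) <;>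
    cases h2 : cosetWord x (lo j) <;> cases h3 : cosetWord x (hi j) <;>
  simp only [p1, p2, p3, q1, q2, q3, w3, w4, w5, w6, h0, h1, h2, h3, map_add, map_smul, e] <;>
  module

/-- The Hecke algebra acting on the module `M⁻` through the operators `T_i`. -/
def rep (N K : ℕ) : Hecke N →ₐ[R] Module.End R (M N K) :=
  heckeLift (FreeAlgebra.lift R op) fun a b h => by
    cases h with
    | quadratic i =>
      simp only [map_mul, map_sub, map_add, AlgHom.commutes, FreeAlgebra.lift_ι_apply, map_zero]
      exact op_quadratic i
    | braid i j h =>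
      simp only [map_mul, FreeAlgebra.lift_ι_apply]
      exact op_braid i j h
    | comm i j h =>
      simp only [map_mul, FreeAlgebra.lift_ι_apply]
      exact op_comm i j h

lemma rep_gen {N K : ℕ} (i : Fin (N - 1)) : rep N K (gen i) = op i :=
  (heckeLift_proj _ _ _).trans (FreeAlgebra.lift_ι_apply _ _)

/-- The projection `φ⁻` from the Hecke algebra to `M⁻`: the `H`-linear map with `1 ↦ m_e`,
where `e` is the coset of the identity. On the standard basis it is the map
`T_v ↦ (-t⁻¹) ^ (|v| - |vP|) m_{vP}`, see `phi_reduced`. -/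
def phi (N K : ℕ) : Hecke N →ₗ[R] M N K :=
  (LinearMap.applyₗ (m (idCoset N K))).comp (rep N K).toLinearMap

lemma phi_apply {N K : ℕ} (h : Hecke N) : phi N K h = rep N K h (m (idCoset N K)) := rfl

lemma length_adj_mul_le {N : ℕ} (i : Fin (N - 1)) (w : Equiv.Perm (Fin N)) :
    length (adj i * w) ≤ length w + 1 := by
  have : inversions (adj i * w) ⊆ insert (w⁻¹ (lo i), w⁻¹ (hi i)) (inversions w) := by
    intro p hp
    obtain ⟨a, b⟩ := p
    rcases inversions_adj_mul i w hp with h | ⟨ha, hb⟩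
    · exact Finset.mem_insert_of_mem h
    · rw [← ha, ← hb, perm_inv_apply, perm_inv_apply]
      exact Finset.mem_insert_self _ _
  exact (Finset.card_le_card this).trans (Finset.card_insert_le _ _)

lemma cosetLength_adj_le {N K : ℕ} (i : Fin (N - 1)) (x : Coset N K) :
    cosetLength (adj i • x) ≤ cosetLength x + 1 := by
  obtain ⟨v, rfl, hv⟩ := exists_cosetLength x
  calc cosetLength (adj i • (v : Coset N K)) ≤ length (adj i * v) := cosetLength_le _
    _ ≤ length v + 1 := length_adj_mul_le i v
    _ = _ := by rw [hv]

lemma length_one {N : ℕ} : length (1 : Equiv.Perm (Fin N)) = 0 := by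
  rw [length, Finset.card_eq_zero, Finset.eq_empty_iff_forall_notMem]
  rintro ⟨a, b⟩ h
  rw [mem_inversions] at h
  exact h.1.asymm h.2

/-- The value of `φ⁻` at `T_v = T_{i_1} ⋯ T_{i_k}`, where `v = s_{i_1} ⋯ s_{i_k}` is reduced. -/
theorem phi_reduced {N K : ℕ} (l : List (Fin (N - 1)))
    (hl : length (l.map adj).prod = l.length) :
    phi N K (l.map gen).prod =
      (-T (-1) : R) ^ (length (l.map adj).prod -
        cosetLength ((l.map adj).prod : Coset N K)) • m ((l.map adj).prod : Coset N K) := by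
  have hle : ∀ l : List (Fin (N - 1)), length (l.map adj).prod ≤ l.length := by
    intro l
    induction l with
    | nil => simp [length_one]
    | cons i l ih =>
      rw [List.map_cons, List.prod_cons, List.length_cons]
      exact (length_adj_mul_le i _).trans (by omega)
  induction l with
  | nil => simp [phi_apply, length_one, idCoset]
  | cons i l ih =>
    have h1 := hle l
    rw [List.map_cons, List.prod_cons, List.length_cons] at hl
    rw [List.map_cons, List.map_cons, List.prod_cons, List.prod_cons]
    generalize hv : (l.map adj).prod = v at *
    have h2 := length_adj_mul_le i v
    specialize ih (by omega)
    rw [phi_apply, map_mul, Module.End.mul_apply, ← phi_apply, ih, map_smul, rep_gen]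
    have hx : ((adj i * v : Equiv.Perm (Fin N)) : Coset N K) = adj i • (v : Coset N K) := rfl
    have h3 := cosetLength_le (K := K) v
    have h4 := cosetLength_le (K := K) (adj i * v)
    rw [hx] at h4 ⊢
    cases h0 : cosetWord (v : Coset N K) (lo i) <;> cases h1' : cosetWord (v : Coset N K) (hi i)
    · rw [op_same i _ (h0.trans h1'.symm), adj_smul_eq i _ (h0.trans h1'.symm), smul_smul,
        ← pow_succ]
      congr 2
      omega
    · rw [op_up i _ h0 h1']
      have := cosetLength_lt i _ h0 h1'
      have := cosetLength_adj_le i (v : Coset N K)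
      congr 2
      omega
    · exfalso
      rw [cosetWord_mk] at h0 h1'
      simp only [word, decide_eq_false_iff_not, decide_eq_true_eq] at h0 h1'
      have := length_adj_mul_lt i v (by rw [Fin.lt_def]; omega)
      omega
    · rw [op_same i _ (h0.trans h1'.symm), adj_smul_eq i _ (h0.trans h1'.symm), smul_smul,
        ← pow_succ]
      congr 2
      omega

/-! ### Parabolic Kazhdan--Lusztig polynomials -/

/-- `b` is the bar involution of `M⁻`: it commutes with the bar involution of the Hecke algebra
through the projection `φ⁻`. -/
def IsBarInvolution {N K : ℕ} (b : M N K → M N K) : Prop :=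
  ∀ h : Hecke N, b (phi N K h) = phi N K (bar N h)

/-- `p ∈ t⁻¹ ℤ[t⁻¹]`. -/
def IsNegative (p : R) : Prop :=
  ∃ q : Polynomial ℤ, p = invert (Polynomial.toLaurent (Polynomial.X * q))

/-- `C` is the Kazhdan--Lusztig basis of `M⁻` with respect to the bar involution `b`. The
coefficient of `m_x` in `C_y` is `C y x`. -/
structure IsKLBasis {N K : ℕ} (b : M N K → M N K) (C : Module.Basis (Coset N K) R (M N K)) :
    Prop where
  bar_eq : ∀ y, b (C y) = C y
  triangular : ∀ x y, ¬ CosetLE x y → C y x = 0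
  diagonal : ∀ x, C x x = 1
  negative : ∀ x y, CosetLE x y → x ≠ y → IsNegative (C y x)

/-- The polynomial `P⁻_{α,β}(t⁻¹)`, for paths `α` and `β`, read off the Kazhdan--Lusztig
basis `C`. -/
def klPoly {N K : ℕ} (hK : K ≤ N) (C : Module.Basis (Coset N K) R (M N K)) (α β : Path N K) : R :=
  C ((pathEquiv hK).symm β) ((pathEquiv hK).symm α)

/-! ### Dyck strips -/

/-- The height of the path `α` at abscissa `x`; the path starts at `(0, 0)`. -/
def height {N K : ℕ} (α : Path N K) (x : ℕ) : ℤ :=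
  ∑ i : Fin N, if i.1 < x then (if α.1 i then 1 else -1) else 0

/-- `α` is (weakly) below `β`. -/
def PathLE {N K : ℕ} (α β : Path N K) : Prop := ∀ x : ℕ, height α x ≤ height β x

/-- The unit boxes (rotated by 45 degrees, given by their centers) that lie between the lower
path `α` and the upper path `β`. The vertices of paths are points `(x, y)` with `x + y` even, and
the box with center `(x, y)`, where `x + y` is odd, has vertices `(x ± 1, y)` and `(x, y ± 1)`. -/
def region {N K : ℕ} (α β : Path N K) : Finset (ℤ × ℤ) :=
  (Finset.range (N + 1)).biUnion fun x =>
    ((Finset.Ioo (height α x) (height β x)).filter fun y => Odd ((x : ℤ) + y)).image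
      fun y => ((x : ℤ), y)

/-- A Dyck strip: the boxes centered at the vertices of a Dyck path of length `2 l`, which starts
at `(x, p 0)`, has height `p k` at abscissa `x + k`, and ends at `(x + 2 l, p 0)`. -/
def IsDyckStrip (D : Finset (ℤ × ℤ)) : Prop :=
  ∃ (x : ℤ) (l : ℕ) (p : ℕ → ℤ),
    (∀ k < 2 * l, p (k + 1) = p k + 1 ∨ p (k + 1) = p k - 1) ∧
    (∀ k ≤ 2 * l, p 0 ≤ p k) ∧ p (2 * l) = p 0 ∧
    D = (Finset.range (2 * l + 1)).image fun k : ℕ => (x + (k : ℤ), p k)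

/-- The boxes just above, NW and NE of the box `c`. -/
def upperNeighbors (c : ℤ × ℤ) : Finset (ℤ × ℤ) :=
  {(c.1, c.2 + 2), (c.1 - 1, c.2 + 1), (c.1 + 1, c.2 + 1)}

/-- Rule II for the ordered pair `(D, D')`: if some box of `D'` is just above, NW or NE of a box
of `D`, then all boxes just above, NW and NE of a box of `D` belong to `D` or `D'`. -/
def RuleII (D D' : Finset (ℤ × ℤ)) : Prop :=
  (∃ c ∈ D, ∃ c' ∈ D', c' ∈ upperNeighbors c) → ∀ c ∈ D, upperNeighbors c ⊆ D ∪ D'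

open Classical in
/-- The configurations of Dyck strips that fill the region between `α` and `β` without overlap. -/
def Conf {N K : ℕ} (α β : Path N K) : Finset (Finset (Finset (ℤ × ℤ))) :=
  (region α β).powerset.powerset.filter fun 𝒟 =>
    (∀ D ∈ 𝒟, IsDyckStrip D) ∧ (∀ D ∈ 𝒟, ∀ D' ∈ 𝒟, D ≠ D' → Disjoint D D') ∧
      𝒟.biUnion id = region α β

open Classical in
/-- The configurations in which all ordered pairs of distinct Dyck strips satisfy Rule II. -/
def ConfII {N K : ℕ} (α β : Path N K) : Finset (Finset (Finset (ℤ × ℤ))) :=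
  (Conf α β).filter fun 𝒟 => ∀ D ∈ 𝒟, ∀ D' ∈ 𝒟, D ≠ D' → RuleII D D'

open Classical in
/-- The generating function `Q^{II,-}_{α,β}(t⁻¹)`. -/
def QII {N K : ℕ} (α β : Path N K) : R :=
  if α = β then 1
  else if PathLE α β then ∑ 𝒟 ∈ ConfII α β, T (-(𝒟.card : ℤ))
  else 0

/-! ### Link patterns -/

/-- The steps `i < j` of the path `β` are paired in its link pattern: their midpoints
`(i + 1/2, ·)` and `(j + 1/2, ·)` have equal height and the open horizontal segment between them
stays strictly below the path. (Twice the height of the midpoint of step `i` is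
`height β i + height β (i + 1)`.) -/
def IsPairing {N K : ℕ} (β : Path N K) (i j : Fin N) : Prop :=
  i < j ∧ height β i + height β (i + 1) = height β j + height β (j + 1) ∧
    ∀ k : ℕ, i.1 < k → k ≤ j.1 → height β i + height β (i + 1) < 2 * height β k

/-- The set `F(β)` of the paths obtained from `β` by flipping the pairings of some set `S`, i.e.
by replacing the letters `2, 1` at the two ends of each of these pairings by `1, 2`. -/
def flips {N K : ℕ} (β : Path N K) : Set (Path N K) :=
  {α | PathLE α β ∧ ∃ S : Set (Fin N × Fin N),
    (∀ p ∈ S, IsPairing β p.1 p.2 ∧ α.1 p.1 = false ∧ α.1 p.2 = true) ∧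
    ∀ k, (∀ p ∈ S, k ≠ p.1 ∧ k ≠ p.2) → α.1 k = β.1 k}

/-- `d(α, β)`: half the number of positions where `α` and `β` differ. (That number is even, as
`α` and `β` have the same number of letters `1`.) -/
def dist {N K : ℕ} (α β : Path N K) : ℕ :=
  (Finset.univ.filter fun i => α.1 i ≠ β.1 i).card / 2

end ParabolicKL

end

/-!
Strings are encoded by `true` for the letter `2` (up step) and `false` for the letter `1` (down
step). Put `E_i = T_i + t⁻¹` (`tl i`), an operator fixed by the bar involution, and let
`C_y = ∑ t^{-d(x, y)} m_x` (`klVec y`), where the sum is over the flips `x` of `y`. The theorem says that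
the `C_y` are the Kazhdan--Lusztig basis and that the tilings by Dyck strips count the same flips.

**The coefficients.** Reading a path from the left, up steps are pushed on a stack and each down
step pops its partner in the link pattern. Hence the flips of `β` and their weights are computed
by a stack automaton `run` (`coeff_eq`), and identities between the coefficients of `C_y` for
different `y` reduce to identities of the automaton on two consecutive letters. The most important
one is `run_valley`; it gives `E_i C_{s_i y} = C_y` whenever `y` has a peak at `i` (`tl_klVec`).

**The bar involution.** The `C_y` are unitriangular with respect to the length, so that they form
a basis, and there is a unique semilinear map `barM` fixing all of them. It commutes with every
`E_i` because `E_i C_y` is a combination of the `C_γ` with coefficients invariant under `t ↦ t⁻¹`.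
This is clear if `y` has a peak or a valley at `i`. If `y` has two equal letters there,
`tl_klVec_same` removes a peak `j` of `y` by writing `C_y = E_j C_{s_j y}`; then `E_i` is moved
past `E_j`, or the relation `E_i E_j E_i = E_i` applies. As `C_e = m_e`, the map `barM` is the bar
involution (`isBarInvolution_barM`), and it is the only one as `φ⁻` is surjective. The `C_y`
satisfy the conditions on the Kazhdan--Lusztig basis, and are characterized by them since a bar
invariant vector with coefficients in `t⁻¹ ℤ[t⁻¹]` vanishes (`eq_zero_of_barM_eq`).

**The Dyck strips.** The box with exactly `r` boxes between it and `β` in its column has depth `r`. In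
a tiling which satisfies Rule II, no strip can lie on top of a strip with a box of depth `0`, and a strip
with a box of depth `r + 1` is covered by the strip which contains the box above. By induction on
the depth (`IsTiling.shape`), every strip has constant depth and runs along a pairing of `β`,
strictly inside the pairing of the strip that covers it. This forces `α` to be the flip of `β` at
these pairings, and the depth of each strip to be the number of flipped pairings around it.
Conversely, the strips defined in this way for a flip `α` form a tiling which satisfies Rule II
(`isTiling_flipStrips`). So there is exactly one tiling if `α` is a flip, it has `d(α, β)` strips,
and there is none otherwise (`QII_eq`).
-/

noncomputable section

namespace ParabolicKL

/-! ### Heights and pairings -/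

/-- The letters of a binary string, indexed by `ℕ` and continued by `false` beyond the string. -/
def letter {N : ℕ} (b : Fin N → Bool) (k : ℕ) : Bool := if h : k < N then b ⟨k, h⟩ else false

@[simp] lemma letter_val {N : ℕ} (b : Fin N → Bool) (i : Fin N) : letter b i = b i := by
  simp [letter]

lemma letter_mk {N : ℕ} (b : Fin N → Bool) {k : ℕ} (h : k < N) : letter b k = b ⟨k, h⟩ := by
  simp [letter, h]

lemma height_zero {N K : ℕ} (α : Path N K) : height α 0 = 0 := by simp [height]

lemma height_succ {N K : ℕ} (α : Path N K) {k : ℕ} (hk : k < N) :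
    height α (k + 1) = height α k + if letter α.1 k then 1 else -1 := by
  have h : height α (k + 1) = height α k +
      ∑ i : Fin N, if i = ⟨k, hk⟩ then (if α.1 i then (1 : ℤ) else -1) else 0 := by
    rw [height, height, ← Finset.sum_add_distrib]
    refine Finset.sum_congr rfl fun i _ => ?_
    simp only [Fin.ext_iff]
    split_ifs <;> omega
  rw [h, Finset.sum_ite_eq' Finset.univ, if_pos (Finset.mem_univ _), letter_mk _ hk]

lemma height_succ_true {N K : ℕ} (α : Path N K) {k : ℕ} (hk : k < N) (h : letter α.1 k = true) :
    height α (k + 1) = height α k + 1 := by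
  rw [height_succ α hk, h]; rfl

lemma height_succ_false {N K : ℕ} (α : Path N K) {k : ℕ} (hk : k < N)
    (h : letter α.1 k = false) : height α (k + 1) = height α k - 1 := by
  rw [height_succ α hk, h]; rfl

lemma height_of_le {N K : ℕ} (α : Path N K) {x : ℕ} (hx : N ≤ x) :
    height α x = N - 2 * K := by
  have h1 : height α x = ∑ i : Fin N, ((1 : ℤ) - 2 * if α.1 i = false then 1 else 0) := by
    refine Finset.sum_congr rfl fun i _ => ?_
    rw [if_pos (by omega)]
    cases α.1 i <;> rfl
  rw [h1, Finset.sum_sub_distrib, ← Finset.mul_sum, Finset.sum_boole, α.2]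
  simp

/-- The two letters of step `k` can be read off the heights. -/
lemma height_step {N K : ℕ} (α : Path N K) {k : ℕ} (hk : k < N) :
    (letter α.1 k = true ∧ height α (k + 1) = height α k + 1) ∨
      (letter α.1 k = false ∧ height α (k + 1) = height α k - 1) := by
  cases h : letter α.1 k
  · exact Or.inr ⟨rfl, height_succ_false α hk h⟩
  · exact Or.inl ⟨rfl, height_succ_true α hk h⟩

lemma even_height_sub {N K : ℕ} (α β : Path N K) (k : ℕ) : Even (height β k - height α k) := by
  induction k with
  | zero => simp [height_zero]
  | succ k ih =>
    rcases lt_or_ge k N with hk | hk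
    · rcases height_step α hk with ⟨-, h⟩ | ⟨-, h⟩ <;>
      rcases height_step β hk with ⟨-, h'⟩ | ⟨-, h'⟩ <;> rw [h, h'] <;> grind
    · rw [height_of_le α (by omega), height_of_le β (by omega)]; simp

lemma even_height_add {N K : ℕ} (α : Path N K) {k : ℕ} (hk : k ≤ N) :
    Even (height α k + k) := by
  induction k with
  | zero => simp [height_zero]
  | succ k ih =>
    specialize ih (by omega)
    rcases height_step α (k := k) (by omega) with ⟨-, h⟩ | ⟨-, h⟩ <;> rw [h] <;> push_cast <;> grind

/-- A path is determined by its heights. -/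
lemma path_ext {N K : ℕ} {α β : Path N K} (h : ∀ k ≤ N, height α k = height β k) : α = β := by
  refine Subtype.ext (funext fun i => ?_)
  rw [← letter_val α.1, ← letter_val β.1]
  have h0 := h i i.2.le
  have h1 := h (i + 1) i.2
  rcases height_step α i.2 with ⟨e, h2⟩ | ⟨e, h2⟩ <;>
  rcases height_step β i.2 with ⟨e', h3⟩ | ⟨e', h3⟩ <;> rw [e, e'] <;> omega

/-- The pairings of the link pattern in terms of the vertices of the path: the vertex before
step `i` and the vertex after step `j` have the same height, and the path stays strictly above this
height in between. -/
def Paired {N K : ℕ} (β : Path N K) (i j : ℕ) : Prop :=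
  i < j ∧ j < N ∧ height β i = height β (j + 1) ∧ ∀ k, i < k → k ≤ j → height β i < height β k

lemma isPairing_iff {N K : ℕ} (β : Path N K) (i j : Fin N) :
    IsPairing β i j ↔ Paired β i j := by
  have hi := height_step β i.2
  have hj := height_step β j.2
  constructor
  · rintro ⟨h1, h2, h3⟩
    have h4 := h3 (i + 1) (by omega) h1
    have h5 := h3 j h1 le_rfl
    refine ⟨h1, j.2, by omega, fun k hk hk' => ?_⟩
    have := h3 k hk hk'
    omega
  · rintro ⟨h1, -, h2, h3⟩
    have h4 := h3 (i + 1) (by omega) h1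
    have h5 := h3 j h1 le_rfl
    refine ⟨h1, by omega, fun k hk hk' => ?_⟩
    have := h3 k hk hk'
    omega

lemma Paired.letter_left {N K : ℕ} {β : Path N K} {i j : ℕ} (h : Paired β i j) :
    letter β.1 i = true := by
  have := h.2.2.2 (i + 1) (by omega) h.1
  rcases height_step β (h.1.trans h.2.1) with h | h
  · exact h.1
  · omega

lemma Paired.letter_right {N K : ℕ} {β : Path N K} {i j : ℕ} (h : Paired β i j) :
    letter β.1 j = false := by
  have := h.2.2.2 j h.1 le_rfl
  have := h.2.2.1
  rcases height_step β h.2.1 with h | h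
  · omega
  · exact h.1

/-- The link pattern is noncrossing. -/
lemma Paired.nested {N K : ℕ} {β : Path N K} {i j i' j' : ℕ} (h : Paired β i j)
    (h' : Paired β i' j') (h1 : i < i') (h2 : i' ≤ j) : j' < j := by
  have h3 := h.2.2.2 i' h1 h2
  have h4 := h.2.2.1
  have h5 := h'.2.2.1
  have h6 := h'.1
  by_contra! hlt
  rcases hlt.eq_or_lt with rfl | hlt
  · omega
  · have := h'.2.2.2 (j + 1) (by omega) (by omega)
    omega

lemma Paired.right_unique {N K : ℕ} {β : Path N K} {i j j' : ℕ} (h : Paired β i j)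
    (h' : Paired β i j') : j = j' := by
  have h4 := h.2.2.1
  have h5 := h'.2.2.1
  have h6 := h'.1
  have h7 := h.1
  rcases lt_trichotomy j j' with hlt | h | hlt
  · have := h'.2.2.2 (j + 1) (by omega) (by omega); omega
  · exact h
  · have := h.2.2.2 (j' + 1) (by omega) (by omega); omega

lemma Paired.left_unique {N K : ℕ} {β : Path N K} {i i' j : ℕ} (h : Paired β i j)
    (h' : Paired β i' j) : i = i' := by
  have h6 := h'.1
  have h7 := h.1
  rcases lt_trichotomy i i' with hlt | e | hlt
  · exact absurd (h.nested h' hlt (by omega)) (lt_irrefl _)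
  · exact e
  · exact absurd (h'.nested h hlt (by omega)) (lt_irrefl _)

/-! ### The stack of open up steps -/

/-- The up steps before the vertex `n` which are not yet paired with a down step before `n`, the
last one first: reading the path from the left, up steps are pushed and down steps pop their
partner. -/
def openSteps {N K : ℕ} (β : Path N K) : ℕ → List ℕ
  | 0 => []
  | n + 1 => if letter β.1 n then n :: openSteps β n else (openSteps β n).tail

lemma openSteps_cons {N K : ℕ} (β : Path N K) (n : ℕ) (hn : n ≤ N) (x : ℕ) (s : List ℕ)
    (h : openSteps β n = x :: s) :
    x < n ∧ s = openSteps β x ∧ height β x + 1 = height β n ∧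
      ∀ k, x < k → k ≤ n → height β x < height β k := by
  induction n using Nat.strong_induction_on generalizing x s with | _ n ih
  cases n with
  | zero => simp [openSteps] at h
  | succ n =>
    rw [openSteps] at h
    rcases height_step β hn with ⟨h1, h2⟩ | ⟨h1, h2⟩
    · rw [h1, if_pos rfl, List.cons.injEq] at h
      obtain ⟨rfl, rfl⟩ := h
      refine ⟨by omega, rfl, by omega, fun k hk hk' => ?_⟩
      obtain rfl : k = n + 1 := by omega
      omega
    · rw [h1, if_neg (by simp)] at h
      cases h0 : openSteps β n with
      | nil => simp [h0] at h
      | cons y s0 =>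
        obtain ⟨hy, rfl, hy2, hy3⟩ := ih n (by omega) (by omega) _ _ h0
        rw [h0, List.tail_cons] at h
        obtain ⟨hx, hs, hx2, hx3⟩ := ih y (by omega) (by omega) _ _ h
        refine ⟨by omega, hs, by omega, fun k hk hk' => ?_⟩
        rcases le_or_gt k y with h3 | h3
        · exact hx3 k hk h3
        · rcases hk'.eq_or_lt with rfl | h4
          · omega
          · have := hy3 k h3 (by omega)
            omega

lemma openSteps_nil {N K : ℕ} (β : Path N K) (n : ℕ) (hn : n ≤ N) (h : openSteps β n = []) :
    ∀ k ≤ n, height β n ≤ height β k := by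
  induction n using Nat.strong_induction_on with | _ n ih
  cases n with
  | zero => intro k hk; obtain rfl : k = 0 := by omega
            exact le_rfl
  | succ n =>
    intro k hk
    rw [openSteps] at h
    rcases height_step β hn with ⟨h1, h2⟩ | ⟨h1, h2⟩
    · simp [h1] at h
    · rw [h1, if_neg (by simp)] at h
      rcases hk.eq_or_lt with rfl | hk
      · exact le_rfl
      cases h0 : openSteps β n with
      | nil =>
        have := ih n (by omega) (by omega) h0 k (by omega)
        omega
      | cons y s0 =>
        obtain ⟨hy, rfl, hy2, hy3⟩ := openSteps_cons β n (by omega) _ _ h0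
        rw [h0, List.tail_cons] at h
        rcases le_or_gt k y with h3 | h3
        · have := ih y (by omega) (by omega) h k h3
          omega
        · have := hy3 k h3 (by omega)
          omega

/-- The partner of a down step is the last open up step. -/
lemma paired_of_openSteps {N K : ℕ} (β : Path N K) {n : ℕ} (hn : n < N)
    (hd : letter β.1 n = false) {x : ℕ} {s : List ℕ} (h : openSteps β n = x :: s) :
    Paired β x n := by
  obtain ⟨h1, -, h2, h3⟩ := openSteps_cons β n hn.le x s h
  have := height_succ_false β hn hd
  exact ⟨h1, hn, by omega, h3⟩

lemma Paired.openSteps_eq {N K : ℕ} {β : Path N K} {i n : ℕ} (h : Paired β i n) :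
    openSteps β n = i :: openSteps β i := by
  cases h0 : openSteps β n with
  | nil =>
    have h1 := openSteps_nil β n h.2.1.le h0 i h.1.le
    have h2 := h.2.2.2 n h.1 le_rfl
    omega
  | cons x s =>
    obtain rfl := h.left_unique (paired_of_openSteps β h.2.1 h.letter_right h0)
    rw [(openSteps_cons β n h.2.1.le _ _ h0).2.1]

lemma Paired.openSteps_succ {N K : ℕ} {β : Path N K} {i n : ℕ} (h : Paired β i n) :
    openSteps β (n + 1) = openSteps β i := by
  rw [openSteps, h.letter_right, h.openSteps_eq]; rfl

/-- Inside a pairing its left end stays open. -/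
lemma Paired.openSteps_append {N K : ℕ} {β : Path N K} {i j : ℕ} (h : Paired β i j) {k : ℕ}
    (hk : i < k) (hkj : k ≤ j) : ∃ s, openSteps β k = s ++ i :: openSteps β i := by
  induction k, hk using Nat.le_induction with
  | base => exact ⟨[], by rw [Nat.succ_eq_add_one, openSteps, h.letter_left]; rfl⟩
  | succ k hk ih =>
    obtain ⟨s, hs⟩ := ih (by omega)
    have hkN : k < N := by have := h.2.1; omega
    rcases height_step β hkN with ⟨h1, h2⟩ | ⟨h1, h2⟩
    · exact ⟨k :: s, by rw [openSteps, h1, if_pos rfl, hs]; rfl⟩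
    · cases s with
      | nil =>
        have := h.right_unique (paired_of_openSteps β hkN h1 hs)
        omega
      | cons x s => exact ⟨s, by rw [openSteps, h1, hs]; rfl⟩

lemma height_lt_of_mem_openSteps {N K : ℕ} (β : Path N K) (n : ℕ) (hn : n ≤ N) (x : ℕ)
    (h : x ∈ openSteps β n) : x < n ∧ ∀ k, x < k → k ≤ n → height β x < height β k := by
  induction n using Nat.strong_induction_on with | _ n ih
  cases h0 : openSteps β n with
  | nil => simp [h0] at h
  | cons y s =>
    obtain ⟨h1, rfl, h2, h3⟩ := openSteps_cons β n hn y s h0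
    rw [h0, List.mem_cons] at h
    rcases h with rfl | h
    · exact ⟨h1, h3⟩
    · obtain ⟨h4, h5⟩ := ih y h1 (by omega) h
      refine ⟨by omega, fun k hk hk' => ?_⟩
      rcases le_or_gt k y with h6 | h6
      · exact h5 k hk h6
      · exact (h5 y h4 le_rfl).trans (h3 k h6 hk')

/-- An up step stays open until it is paired. -/
lemma mem_openSteps_or_paired {N K : ℕ} (β : Path N K) {x : ℕ} (hx : letter β.1 x = true)
    {n : ℕ} (hxn : x < n) (hn : n ≤ N) : x ∈ openSteps β n ∨ ∃ j < n, Paired β x j := by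
  induction n, hxn using Nat.le_induction with
  | base => left; rw [Nat.succ_eq_add_one, openSteps, hx]; simp
  | succ n hxn ih =>
    rcases ih (by omega) with h | ⟨j, h1, h2⟩
    · rcases height_step β (show n < N by omega) with ⟨h1, -⟩ | ⟨h1, -⟩
      · left; rw [openSteps, h1, if_pos rfl]; exact List.mem_cons_of_mem _ h
      · cases h0 : openSteps β n with
        | nil => simp [h0] at h
        | cons y s =>
          rw [h0, List.mem_cons] at h
          rcases h with rfl | h
          · exact Or.inr ⟨n, by omega, paired_of_openSteps β hn h1 h0⟩
          · left; rw [openSteps, h1, h0]; exact h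
    · exact Or.inr ⟨j, by omega, h2⟩

/-! ### The flips of a path as accepted by a stack automaton -/

/-- The letter of a flip `α` at a down step of `β`, given the stack of letters of `α` at the open
up steps of `β`: an unpaired step is kept, and a paired step is opposite to its partner. -/
def popLetter : List Bool → Bool
  | [] => false
  | x :: _ => !x

/-- The stack automaton that reads pairs of letters `(β_k, α_k)`: an up step of `β` pushes the
letter of `α`, a down step of `β` pops a letter, and is rejected unless the letter of `α` is the
one prescribed by `popLetter`. The value is `0` if the word is rejected or if some flipped step
remains open, and otherwise it is `t⁻¹` to the number of flipped pairings. -/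
def run : List Bool → List (Bool × Bool) → R
  | s, [] => if ∀ x ∈ s, x = true then 1 else 0
  | s, (true, a) :: w => run (a :: s) w
  | s, (false, a) :: w => if a = popLetter s then (if a then T (-1) else 1) * run s.tail w else 0

/-- The list of the pairs of letters at the positions `n, …, n + r - 1`. -/
def letters {N : ℕ} (b a : Fin N → Bool) (n r : ℕ) : List (Bool × Bool) :=
  (List.range' n r).map fun k => (letter b k, letter a k)

/-- The coefficient of `m_α` in `C⁻_β`, as computed by the stack automaton. -/
def coeff {N : ℕ} (b a : Fin N → Bool) : R := run [] (letters b a 0 N)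

lemma letters_succ {N : ℕ} (b a : Fin N → Bool) (n r : ℕ) :
    letters b a n (r + 1) = (letter b n, letter a n) :: letters b a (n + 1) r := rfl

/-- The stack of the automaton after reading `n` letters of an accepted word. -/
def flags {N K : ℕ} (β α : Path N K) (n : ℕ) : List Bool := (openSteps β n).map (letter α.1)

/-- The condition checked by the automaton at the down steps. -/
def PopOk {N K : ℕ} (β α : Path N K) (k : ℕ) : Prop :=
  letter β.1 k = false → letter α.1 k = popLetter (flags β α k)

open Classical in
lemma run_flags {N K : ℕ} (β α : Path N K) (r n : ℕ) (h : n + r = N) :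
    run (flags β α n) (letters β.1 α.1 n r) =
      if (∀ k, n ≤ k → k < N → PopOk β α k) ∧ ∀ x ∈ flags β α N, x = true then
        T (-(∑ k ∈ Finset.Ico n N, if letter β.1 k = false ∧ letter α.1 k = true then 1 else 0 : ℕ))
      else 0 := by
  induction r generalizing n with
  | zero =>
    obtain rfl : n = N := h
    have hk : ∀ k, n ≤ k → k < n → PopOk β α k := fun k h1 h2 => by omega
    simp only [letters, run, List.range'_zero, List.map_nil, Finset.Ico_self, Finset.sum_empty,
      Nat.cast_zero, neg_zero, T_zero, and_iff_right hk]
  | succ r ih =>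
    specialize ih (n + 1) (by omega)
    have hn : n < N := by omega
    have hsplit : (∀ k, n ≤ k → k < N → PopOk β α k) ↔
        PopOk β α n ∧ ∀ k, n + 1 ≤ k → k < N → PopOk β α k :=
      ⟨fun H => ⟨H n le_rfl hn, fun k hk => H k (by omega)⟩, fun H k hk hk' => by
        rcases hk.eq_or_lt with rfl | hk
        · exact H.1
        · exact H.2 k hk hk'⟩
    simp only [letters_succ, hsplit, Finset.sum_eq_sum_Ico_succ_bot hn]
    cases hb : letter β.1 n
    · have ht : (flags β α n).tail = flags β α (n + 1) := by
        rw [flags, flags, openSteps, hb, if_neg (by simp), List.map_tail]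
      rw [run, ht, ih]
      by_cases hp : letter α.1 n = popLetter (flags β α n)
      · have hok : PopOk β α n := fun _ => hp
        rw [if_pos hp]
        simp only [hok, true_and]
        rw [mul_ite, mul_zero]
        refine if_congr Iff.rfl ?_ rfl
        cases letter α.1 n
        · simp
        · rw [if_pos rfl, if_pos (by simp), ← T_add]
          congr 1
          push_cast
          ring
      · have hok : ¬ PopOk β α n := fun h => hp (h hb)
        simp [hp, hok]
    · have ht : letter α.1 n :: flags β α n = flags β α (n + 1) := by
        rw [flags, flags, openSteps, hb, if_pos rfl, List.map_cons]
      have hok : PopOk β α n := fun h => by simp [hb] at h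
      rw [run, ht, ih]
      simp [hok]

open Classical in
lemma coeff_eq_ite {N K : ℕ} (β α : Path N K) :
    coeff β.1 α.1 =
      if (∀ k < N, PopOk β α k) ∧ ∀ x ∈ flags β α N, x = true then
        T (-(∑ k ∈ Finset.range N, if letter β.1 k = false ∧ letter α.1 k = true then 1 else 0 : ℕ))
      else 0 := by
  have := run_flags β α N 0 (by omega)
  simp only [Nat.zero_le, forall_const, Nat.Ico_zero_eq_range] at this
  exact this

/-- Two paths disagree equally often in the two possible ways. -/
lemma card_filter_eq {N K : ℕ} (α β : Path N K) :
    (Finset.univ.filter fun i => β.1 i = false ∧ α.1 i = true).card =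
      (Finset.univ.filter fun i => β.1 i = true ∧ α.1 i = false).card := by
  have h1 := Finset.card_filter_add_card_filter_not
    (s := Finset.univ.filter fun i => β.1 i = false) (fun i => α.1 i = true)
  have h2 := Finset.card_filter_add_card_filter_not
    (s := Finset.univ.filter fun i => α.1 i = false) (fun i => β.1 i = true)
  rw [β.2, Finset.filter_filter, Finset.filter_filter] at h1
  rw [α.2, Finset.filter_filter, Finset.filter_filter] at h2
  simp only [Bool.not_eq_true] at h1 h2
  have e1 : (Finset.univ.filter fun i => β.1 i = false ∧ α.1 i = false) =
    (Finset.univ.filter fun i => α.1 i = false ∧ β.1 i = false) :=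
    Finset.filter_congr fun i _ => and_comm
  have e2 : (Finset.univ.filter fun i => β.1 i = true ∧ α.1 i = false) =
    (Finset.univ.filter fun i => α.1 i = false ∧ β.1 i = true) :=
    Finset.filter_congr fun i _ => and_comm
  rw [e1] at h1
  rw [e2]
  omega

lemma dist_eq_card {N K : ℕ} (α β : Path N K) :
    dist α β = (Finset.univ.filter fun i => β.1 i = false ∧ α.1 i = true).card := by
  have h : (Finset.univ.filter fun i => α.1 i ≠ β.1 i) =
      (Finset.univ.filter fun i => β.1 i = false ∧ α.1 i = true) ∪
      (Finset.univ.filter fun i => β.1 i = true ∧ α.1 i = false) := by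
    ext i
    simp only [Finset.mem_filter, Finset.mem_union, Finset.mem_univ, true_and]
    cases α.1 i <;> cases β.1 i <;> simp
  rw [dist, h, Finset.card_union_of_disjoint, ← card_filter_eq]
  · omega
  · rw [Finset.disjoint_filter]
    rintro i - ⟨h1, -⟩ ⟨h2, -⟩
    simp [h1] at h2

lemma sum_eq_dist {N K : ℕ} (α β : Path N K) :
    (∑ k ∈ Finset.range N, if letter β.1 k = false ∧ letter α.1 k = true then 1 else 0) =
      dist α β := by
  rw [dist_eq_card, Finset.card_filter, Finset.sum_range]
  simp only [letter_val]

/-- The flipped open steps account for the distance between the two paths. -/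
lemma height_sub_eq_count {N K : ℕ} {β α : Path N K} (h : ∀ k < N, PopOk β α k) {n : ℕ}
    (hn : n ≤ N) : height β n - height α n = 2 * ((flags β α n).count false : ℤ) := by
  induction n with
  | zero => simp [height_zero, flags, openSteps]
  | succ n ih =>
    specialize ih (by omega)
    have hp := h n (by omega)
    rcases height_step β (k := n) (by omega) with ⟨h1, h2⟩ | ⟨h1, h2⟩
    · have e : flags β α (n + 1) = letter α.1 n :: flags β α n := by
        rw [flags, flags, openSteps, h1, if_pos rfl, List.map_cons]
      rw [e, List.count_cons]
      rcases height_step α (k := n) (by omega) with ⟨h3, h4⟩ | ⟨h3, h4⟩ <;> simp [h3] <;> omega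
    · have e : flags β α (n + 1) = (flags β α n).tail := by
        rw [flags, flags, openSteps, h1, if_neg (by simp), List.map_tail]
      specialize hp h1
      rw [e]
      cases hf : flags β α n with
      | nil =>
        rw [hf] at hp ih
        rcases height_step α (k := n) (by omega) with ⟨h3, h4⟩ | ⟨h3, h4⟩
        · simp [h3, popLetter] at hp
        · simp at ih ⊢; omega
      | cons x s =>
        rw [hf] at hp ih
        rcases height_step α (k := n) (by omega) with ⟨h3, h4⟩ | ⟨h3, h4⟩ <;>
          cases x <;> simp [h3, popLetter] at hp ih ⊢ <;> omega

/-- The flips of `β` are exactly the words accepted by the automaton. -/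
lemma mem_flips_iff {N K : ℕ} (β α : Path N K) :
    α ∈ flips β ↔ (∀ k < N, PopOk β α k) ∧ ∀ x ∈ flags β α N, x = true := by
  constructor
  · rintro ⟨-, S, hS, hS'⟩
    have key : ∀ i j : ℕ, Paired β i j → letter α.1 j = !letter α.1 i := by
      intro i j hij
      have hiN : i < N := hij.1.trans hij.2.1
      rw [letter_mk _ hiN, letter_mk _ hij.2.1]
      by_cases hm : ((⟨i, hiN⟩, ⟨j, hij.2.1⟩) : Fin N × Fin N) ∈ S
      · rw [(hS _ hm).2.1, (hS _ hm).2.2]; rfl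
      · rw [hS' ⟨j, hij.2.1⟩, hS' ⟨i, hiN⟩, ← letter_mk β.1 hiN, ← letter_mk β.1 hij.2.1,
          hij.letter_left, hij.letter_right]
        · rfl
        all_goals
          intro p hp
          have h1 := (isPairing_iff _ _ _).1 (hS p hp).1
          constructor <;> rintro h2
        · rw [← h2] at h1
          exact hm (by rwa [show ((⟨i, hiN⟩, ⟨j, hij.2.1⟩) : Fin N × Fin N) = p from
            Prod.ext h2 (Fin.ext (hij.right_unique h1))])
        · rw [← h2] at h1
          have := h1.letter_right; rw [hij.letter_left] at this; simp at this
        · rw [← h2] at h1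
          have := h1.letter_left; rw [hij.letter_right] at this; simp at this
        · rw [← h2] at h1
          exact hm (by rwa [show ((⟨i, hiN⟩, ⟨j, hij.2.1⟩) : Fin N × Fin N) = p from
            Prod.ext (Fin.ext (hij.left_unique h1)) h2])
    have key2 : ∀ k, ∀ hk : k < N, (∀ i j, Paired β i j → k ≠ i ∧ k ≠ j) →
        letter α.1 k = letter β.1 k := by
      intro k hk h
      rw [letter_mk _ hk, letter_mk _ hk]
      refine hS' _ fun p hp => ?_
      have := h _ _ ((isPairing_iff _ _ _).1 (hS p hp).1)
      rwa [Ne, Ne, Fin.ext_iff, Fin.ext_iff]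
    constructor
    · intro k hk hd
      cases h0 : openSteps β k with
      | nil =>
        rw [key2 k hk, hd, flags, h0]
        · rfl
        · refine fun i j hij => ⟨?_, ?_⟩ <;> rintro rfl
          · rw [hij.letter_left] at hd; simp at hd
          · rw [hij.openSteps_eq] at h0; simp at h0
      | cons x s =>
        rw [key x k (paired_of_openSteps β hk hd h0), flags, h0]; rfl
    · intro x hx
      obtain ⟨i, hi, rfl⟩ := List.mem_map.1 hx
      obtain ⟨h1, h2⟩ := height_lt_of_mem_openSteps β N le_rfl i hi
      have hi' := h2 (i + 1) (by omega) h1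
      rcases height_step β h1 with ⟨h3, h4⟩ | ⟨h3, h4⟩
      · rw [key2 i h1, h3]
        refine fun i' j hij => ⟨?_, ?_⟩ <;> rintro rfl
        · have h5 := h2 (j + 1) (by have := hij.1; omega) (hij.2.1)
          have := hij.2.2.1; omega
        · rw [hij.letter_right] at h3; simp at h3
      · omega
  · rintro ⟨h1, h2⟩
    have hpop : ∀ i j, Paired β i j → letter α.1 j = !letter α.1 i := by
      intro i j hij
      rw [h1 j hij.2.1 hij.letter_right, flags, hij.openSteps_eq]; rfl
    refine ⟨fun x => ?_, {p | IsPairing β p.1 p.2 ∧ α.1 p.1 = false ∧ α.1 p.2 = true},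
      fun p hp => hp, fun k hk => ?_⟩
    · rcases le_or_gt x N with hx | hx
      · have := height_sub_eq_count h1 hx; omega
      · rw [height_of_le α hx.le, height_of_le β hx.le]
    · rw [← letter_val α.1, ← letter_val β.1]
      by_contra hne
      have hS : ∀ i j, Paired β i j → letter α.1 i = false → k.1 ≠ i ∧ k.1 ≠ j := by
        intro i j hij hi
        have hj := hpop i j hij
        rw [hi] at hj
        have hiN : i < N := hij.1.trans hij.2.1
        rw [letter_mk _ hiN] at hi
        rw [letter_mk _ hij.2.1] at hj
        have := hk (⟨i, hiN⟩, ⟨j, hij.2.1⟩) ⟨(isPairing_iff _ _ _).2 hij, hi, hj⟩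
        simpa [Fin.ext_iff] using this
      cases hb : letter β.1 k
      · rw [hb, Bool.not_eq_false] at hne
        have hp := h1 k k.2 hb
        cases h0 : openSteps β k with
        | nil => rw [flags, h0, hne] at hp; simp [popLetter] at hp
        | cons x s =>
          rw [flags, h0, hne] at hp
          refine (hS x k (paired_of_openSteps β k.2 hb h0) ?_).2 rfl
          simpa [popLetter] using hp.symm
      · rw [hb, Bool.not_eq_true] at hne
        rcases mem_openSteps_or_paired β hb k.2 le_rfl with h | ⟨j, -, h⟩
        · have := h2 _ (List.mem_map_of_mem h)
          rw [hne] at this; simp at this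
        · exact (hS k j h hne).1 rfl

open Classical in
/-- The automaton computes the coefficients of the flips. -/
theorem coeff_eq {N K : ℕ} (β α : Path N K) :
    coeff β.1 α.1 = if α ∈ flips β then T (-(dist α β : ℤ)) else 0 := by
  rw [coeff_eq_ite, sum_eq_dist]
  simp only [mem_flips_iff]

/-! ### Local identities of the automaton -/

/-- A linear relation between the runs on three words is not affected by a common prefix. -/
lemma run_append_linear {w w₁ w₂ : List (Bool × Bool)} {c₁ c₂ : R}
    (h : ∀ s, run s w = c₁ * run s w₁ + c₂ * run s w₂) (p : List (Bool × Bool)) (s : List Bool) :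
    run s (p ++ w) = c₁ * run s (p ++ w₁) + c₂ * run s (p ++ w₂) := by
  induction p generalizing s with
  | nil => exact h s
  | cons x p ih =>
    obtain ⟨b, a⟩ := x
    cases b
    · simp only [List.cons_append, run]
      split_ifs
      · rw [ih]; ring
      · rw [ih]; ring
      · ring
    · exact ih _

lemma run_peak_same (s : List Bool) (x : Bool) (w : List (Bool × Bool)) :
    run s ((true, x) :: (false, x) :: w) = 0 := by
  cases x <;> simp [run, popLetter]

lemma run_peak_true (s : List Bool) (w : List (Bool × Bool)) :
    run s ((true, true) :: (false, false) :: w) = run s w := by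
  simp [run, popLetter]

lemma run_peak_false (s : List Bool) (w : List (Bool × Bool)) :
    run s ((true, false) :: (false, true) :: w) = T (-1) * run s w := by
  simp [run, popLetter]

/-- An unflipped open step at the bottom of the stack is not seen by the automaton. -/
lemma run_append_true (s : List Bool) (w : List (Bool × Bool)) :
    run (s ++ [true]) w = run s w := by
  induction w generalizing s with
  | nil => simp [run, or_imp]
  | cons x w ih =>
    obtain ⟨b, a⟩ := x
    cases b
    · cases s with
      | nil => simp [run, popLetter]
      | cons y s => simp [run, popLetter, ih]
    · rw [run, run, ← List.cons_append, ih]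

/-- A valley of `β` can be removed by summing over the two ways in which the two letters of `α`
can differ. Both steps of the valley change partners: the first one is paired with the top of the
stack, and the second one takes its place. So exactly one of the two summands survives, the first
if the top of the stack is not flipped or the stack is empty, and the second if it is flipped. -/
lemma run_valley (s : List Bool) (w : List (Bool × Bool)) :
    run s w = run s ((false, false) :: (true, true) :: w) +
      T 1 * run s ((false, true) :: (true, false) :: w) := by
  cases s with
  | nil =>
    have := run_append_true [] w
    simpa [run, popLetter] using this.symm
  | cons x s =>
    cases x
    · simp only [run, popLetter, Bool.not_false, List.tail_cons, if_true, ← mul_assoc, T_mul_T_neg]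
      simp
    · simp [run, popLetter]

lemma letters_split {N : ℕ} (b a : Fin N → Bool) (i : Fin (N - 1)) :
    letters b a 0 N = letters b a 0 i ++
      (b (lo i), a (lo i)) :: (b (hi i), a (hi i)) :: letters b a (i + 2) (N - i - 2) := by
  have h : List.range' 0 N = List.range' 0 i ++ List.range' i (N - i - 2 + 1 + 1) := by
    have := List.range'_append_1 (s := 0) (m := i.1) (n := N - i - 2 + 1 + 1)
    rw [zero_add] at this
    rw [this]
    congr 1
    omega
  rw [letters, h, List.map_append, List.range'_succ, List.range'_succ, List.map_cons, List.map_cons]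
  rw [letter_mk b (k := i) (by omega), letter_mk b (k := i + 1) (by omega),
    letter_mk a (k := i) (by omega), letter_mk a (k := i + 1) (by omega)]
  rfl

lemma letters_congr {N : ℕ} {b a b' a' : Fin N → Bool} {n r : ℕ} (h : n + r ≤ N)
    (hb : ∀ k : Fin N, n ≤ k → k.1 < n + r → b k = b' k)
    (ha : ∀ k : Fin N, n ≤ k → k.1 < n + r → a k = a' k) :
    letters b a n r = letters b' a' n r := by
  refine List.map_congr_left fun k hk => ?_
  rw [List.mem_range'_1] at hk
  have hkN : k < N := by omega
  simp only [letter_mk _ hkN]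
  rw [hb ⟨k, hkN⟩ hk.1 hk.2, ha ⟨k, hkN⟩ hk.1 hk.2]

/-- The words of `y`, `s_i y` and of `x`, `s_i x` differ only at the positions `i` and `i + 1`, so
that all four combinations have a common prefix `p` and a common suffix `w`. -/
lemma exists_letters_split {N K : ℕ} (i : Fin (N - 1)) (y x : Coset N K) :
    ∃ p w, ∀ y' ∈ ({y, adj i • y} : Set (Coset N K)), ∀ x' ∈ ({x, adj i • x} : Set (Coset N K)),
      letters (cosetWord y') (cosetWord x') 0 N =
        p ++ (cosetWord y' (lo i), cosetWord x' (lo i)) ::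
          (cosetWord y' (hi i), cosetWord x' (hi i)) :: w := by
  refine ⟨letters (cosetWord y) (cosetWord x) 0 i,
    letters (cosetWord y) (cosetWord x) (i + 2) (N - i - 2), fun y' hy x' hx => ?_⟩
  have key : ∀ z z' : Coset N K, z' ∈ ({z, adj i • z} : Set (Coset N K)) → ∀ k, k ≠ lo i →
      k ≠ hi i → cosetWord z' k = cosetWord z k := by
    rintro z z' (rfl | rfl) k h1 h2
    · rfl
    · exact cosetWord_adj_of_ne i z k h1 h2
  have h1 : ∀ k : Fin N, k.1 < i → k ≠ lo i ∧ k ≠ hi i := fun k hk => by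
    constructor <;> rintro rfl <;> simp [lo, hi] at hk
  have h2 : ∀ k : Fin N, i.1 + 2 ≤ k → k ≠ lo i ∧ k ≠ hi i := fun k hk => by
    constructor <;> rintro rfl <;> simp [lo, hi] at hk
  rw [letters_split _ _ i]
  congr 1
  · apply letters_congr (by omega) <;>
    exact fun k _ hk => key _ _ (by assumption) k (h1 k (by omega)).1 (h1 k (by omega)).2
  · congr 2
    apply letters_congr (by omega) <;>
    exact fun k hk _ => key _ _ (by assumption) k (h2 k hk).1 (h2 k hk).2

variable {N K : ℕ}

/-- The coefficient of `m_x` in `C⁻_y`. -/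
def klCoeff (y x : Coset N K) : R := coeff (cosetWord y) (cosetWord x)

lemma klCoeff_peak_same {i : Fin (N - 1)} {y : Coset N K} (h0 : cosetWord y (lo i) = true)
    (h1 : cosetWord y (hi i) = false) {x : Coset N K}
    (hx : cosetWord x (lo i) = cosetWord x (hi i)) : klCoeff y x = 0 := by
  obtain ⟨p, w, h⟩ := exists_letters_split i y x
  rw [klCoeff, coeff, h y (by simp) x (by simp), h0, h1, hx,
    run_append_linear (c₁ := 0) (c₂ := 0) (w₁ := []) (w₂ := [])]
  · ring
  · intro s; rw [run_peak_same]; ring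

lemma klCoeff_peak_true {i : Fin (N - 1)} {y : Coset N K} (h0 : cosetWord y (lo i) = true)
    (h1 : cosetWord y (hi i) = false) {x : Coset N K} (h0' : cosetWord x (lo i) = true)
    (h1' : cosetWord x (hi i) = false) :
    klCoeff y x = klCoeff (adj i • y) (adj i • x) + T 1 * klCoeff (adj i • y) x := by
  obtain ⟨p, w, h⟩ := exists_letters_split i y x
  rw [klCoeff, coeff, h y (by simp) x (by simp), klCoeff, coeff,
    h (adj i • y) (by simp) (adj i • x) (by simp), klCoeff, coeff,
    h (adj i • y) (by simp) x (by simp)]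
  simp only [cosetWord_adj_lo, cosetWord_adj_hi, h0, h1, h0', h1']
  rw [run_append_linear (c₁ := 1) (c₂ := T 1), one_mul]
  intro s
  rw [run_peak_true, one_mul, run_valley]

lemma klCoeff_peak_false {i : Fin (N - 1)} {y : Coset N K} (h0 : cosetWord y (lo i) = true)
    (h1 : cosetWord y (hi i) = false) {x : Coset N K} (h0' : cosetWord x (lo i) = false)
    (h1' : cosetWord x (hi i) = true) :
    klCoeff y x = T (-1) * klCoeff y (adj i • x) := by
  obtain ⟨p, w, h⟩ := exists_letters_split i y x
  rw [klCoeff, coeff, h y (by simp) x (by simp), klCoeff, coeff,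
    h y (by simp) (adj i • x) (by simp)]
  simp only [cosetWord_adj_lo, cosetWord_adj_hi, h0, h1, h0', h1']
  rw [run_append_linear (c₁ := T (-1)) (c₂ := 0) (w₂ := []), zero_mul, add_zero]
  intro s
  rw [run_peak_false, run_peak_true]; ring

/-! ### The Temperley--Lieb operators -/

/-- The operator `T_i + t⁻¹`, which is invariant under the bar involution. -/
def tl (i : Fin (N - 1)) : Module.End R (M N K) := op i + algebraMap R _ (T (-1))

lemma tl_apply (i : Fin (N - 1)) (v : M N K) : tl i v = op i v + (T (-1) : R) • v := rfl

lemma tl_same (i : Fin (N - 1)) (x : Coset N K) (h : cosetWord x (lo i) = cosetWord x (hi i)) :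
    tl i (m x) = 0 := by
  rw [tl_apply, op_same i x h]; module

lemma tl_up (i : Fin (N - 1)) (x : Coset N K) (h0 : cosetWord x (lo i) = false)
    (h1 : cosetWord x (hi i) = true) :
    tl i (m x) = m (adj i • x) + (T (-1) : R) • m x := by
  rw [tl_apply, op_up i x h0 h1]

lemma tl_down (i : Fin (N - 1)) (x : Coset N K) (h0 : cosetWord x (lo i) = true)
    (h1 : cosetWord x (hi i) = false) :
    tl i (m x) = (T 1 : R) • m x + m (adj i • x) := by
  rw [tl_apply, op_down i x h0 h1]; module

lemma tl_mul_self (i : Fin (N - 1)) (v : M N K) :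
    tl i (tl i v) = (T 1 + T (-1) : R) • tl i v := by
  have := LinearMap.congr_fun (op_quadratic (K := K) i) v
  simp only [Module.End.mul_apply, LinearMap.sub_apply, LinearMap.add_apply,
    Module.algebraMap_end_apply, LinearMap.zero_apply, sub_eq_zero] at this
  rw [tl_apply i (tl i v), tl_apply i v, this]
  module

lemma tl_comm (i j : Fin (N - 1)) (h : i.1 + 1 < j.1) (v : M N K) :
    tl i (tl j v) = tl j (tl i v) := by
  have := LinearMap.congr_fun (op_comm (K := K) i j h) v
  simp only [Module.End.mul_apply] at this
  simp only [tl_apply, map_add, map_smul, this]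
  module

/-- The Temperley--Lieb relation, which holds since the paths have only two kinds of steps. -/
lemma tl_mul_tl_mul_tl (i j : Fin (N - 1)) (h : i.1 + 1 = j.1) :
    (tl i * tl j * tl i : Module.End R (M N K)) = tl i ∧
      (tl j * tl i * tl j : Module.End R (M N K)) = tl j := by
  have hij : lo j = hi i := Fin.ext h.symm
  have hca : hi j ≠ lo i := fun e => by simp only [hi, lo, Fin.ext_iff] at e; omega
  have hcb : hi j ≠ hi i := fun e => by simp only [hi, Fin.ext_iff] at e; omega
  have hac : lo i ≠ lo j := fun e => by simp only [lo, Fin.ext_iff] at e; omega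
  have w1 : ∀ y : Coset N K, cosetWord (adj i • y) (lo i) = cosetWord y (hi i) :=
    cosetWord_adj_lo i
  have w2 : ∀ y : Coset N K, cosetWord (adj i • y) (hi i) = cosetWord y (lo i) :=
    cosetWord_adj_hi i
  have w3 : ∀ y : Coset N K, cosetWord (adj i • y) (hi j) = cosetWord y (hi j) :=
    fun y => cosetWord_adj_of_ne i y _ hca hcb
  have w4 : ∀ y : Coset N K, cosetWord (adj j • y) (hi i) = cosetWord y (hi j) :=
    fun y => hij ▸ cosetWord_adj_lo j y
  have w5 : ∀ y : Coset N K, cosetWord (adj j • y) (hi j) = cosetWord y (hi i) :=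
    fun y => hij ▸ cosetWord_adj_hi j y
  have w6 : ∀ y : Coset N K, cosetWord (adj j • y) (lo i) = cosetWord y (lo i) :=
    fun y => cosetWord_adj_of_ne j y _ hac hca.symm
  have p1 := tl_same (N := N) (K := K) i
  have p2 := tl_up (N := N) (K := K) i
  have p3 := tl_down (N := N) (K := K) i
  have q1 := tl_same (N := N) (K := K) j
  have q2 := tl_up (N := N) (K := K) j
  have q3 := tl_down (N := N) (K := K) j
  have r1 := adj_smul_adj_smul (N := N) (K := K) i
  have r2 := adj_smul_adj_smul (N := N) (K := K) j
  rw [hij] at q1 q2 q3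
  have huv : ∀ v : M N K, (T 1 : R) • (T (-1) : R) • v = v := fun v => by
    rw [smul_smul, T_mul_T_neg, one_smul]
  have hvu : ∀ v : M N K, (T (-1) : R) • (T 1 : R) • v = v := fun v => by
    rw [smul_smul, mul_comm, T_mul_T_neg, one_smul]
  constructor <;> apply end_ext <;> intro x <;> simp only [Module.End.mul_apply] <;>
  cases h0 : cosetWord x (lo i) <;> cases h1 : cosetWord x (hi i) <;>
    cases h2 : cosetWord x (hi j) <;>
  simp only [p1, p2, p3, q1, q2, q3, w1, w2, w3, w4, w5, w6, h0, h1, h2, map_add, map_smul, r1, r2,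
    map_zero, smul_zero, add_zero, zero_add, smul_add, huv, hvu]

lemma m_apply (y x : Coset N K) [Decidable (y = x)] : m y x = if y = x then 1 else 0 :=
  Finsupp.single_apply

lemma single_eq_smul_m (x : Coset N K) (c : R) : (Finsupp.single x c : M N K) = c • m x := by
  rw [m, Finsupp.smul_single, smul_eq_mul, mul_one]

/-- The coordinates of `(T_i + t⁻¹) v`. -/
lemma tl_coord (i : Fin (N - 1)) (v : M N K) (x : Coset N K) :
    tl i v x =
      match cosetWord x (lo i), cosetWord x (hi i) with
      | false, true => T (-1) * v x + v (adj i • x)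
      | true, false => T 1 * v x + v (adj i • x)
      | _, _ => 0 := by
  classical
  induction v using Finsupp.induction_linear with
  | zero => cases cosetWord x (lo i) <;> cases cosetWord x (hi i) <;> simp
  | add v w hv hw =>
    rw [map_add, Finsupp.add_apply, hv, hw]
    cases cosetWord x (lo i) <;> cases cosetWord x (hi i) <;> simp <;> ring
  | single y c =>
    have e : adj i • y = x ↔ y = adj i • x :=
      ⟨fun h => by rw [← h, adj_smul_adj_smul], fun h => by rw [h, adj_smul_adj_smul]⟩
    rw [single_eq_smul_m, map_smul]
    rcases eq_or_ne y x with rfl | h1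
    · have hn := fun h => (adj_smul_ne i y h).symm
      cases h0 : cosetWord y (lo i) <;> cases h1 : cosetWord y (hi i)
      · rw [tl_same i y (by rw [h0, h1])]; simp
      · rw [tl_up i y h0 h1]
        simp [m_apply, hn, h0, h1, e]
      · rw [tl_down i y h0 h1]
        simp [m_apply, hn, h0, h1, e]
      · rw [tl_same i y (by rw [h0, h1])]; simp
    · rcases eq_or_ne y (adj i • x) with rfl | h2
      · cases h0' : cosetWord x (lo i) <;> cases h1' : cosetWord x (hi i)
        · rw [tl_same i _ (by rw [cosetWord_adj_lo, cosetWord_adj_hi, h0', h1'])]; simp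
        · rw [tl_down i _ (by rw [cosetWord_adj_lo, h1']) (by rw [cosetWord_adj_hi, h0'])]
          simp [m_apply, h1, adj_smul_adj_smul]
        · rw [tl_up i _ (by rw [cosetWord_adj_lo, h1']) (by rw [cosetWord_adj_hi, h0'])]
          simp [m_apply, h1, adj_smul_adj_smul]
        · rw [tl_same i _ (by rw [cosetWord_adj_lo, cosetWord_adj_hi, h0', h1'])]; simp
      · cases h0 : cosetWord y (lo i) <;> cases h1' : cosetWord y (hi i) <;>
        [rw [tl_same i y (by rw [h0, h1'])]; rw [tl_up i y h0 h1']; rw [tl_down i y h0 h1'];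
          rw [tl_same i y (by rw [h0, h1'])]] <;>
        cases cosetWord x (lo i) <;> cases cosetWord x (hi i) <;> simp [m_apply, h1, h2, e]

/-! ### The candidate for the Kazhdan--Lusztig basis -/

/-- The element `∑ t^{-d(x, y)} m_x`, where the sum is over the flips `x` of `y`. -/
def klVec (y : Coset N K) : M N K := Finsupp.equivFunOnFinite.symm (klCoeff y)

lemma klVec_apply (y x : Coset N K) : klVec y x = klCoeff y x := rfl

/-- If `y` has a peak at `i`, then `C_y` is obtained by applying `T_i + t⁻¹` to `C_{s_i y}`. -/
lemma tl_klVec (i : Fin (N - 1)) (y : Coset N K) (h0 : cosetWord y (lo i) = true)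
    (h1 : cosetWord y (hi i) = false) : tl i (klVec (adj i • y)) = klVec y := by
  ext1 x
  rw [tl_coord, klVec_apply, klVec_apply, klVec_apply]
  cases h0' : cosetWord x (lo i) <;> cases h1' : cosetWord x (hi i)
  · exact (klCoeff_peak_same h0 h1 (by rw [h0', h1'])).symm
  · rw [klCoeff_peak_false h0 h1 h0' h1', klCoeff_peak_true h0 h1
      (by rw [cosetWord_adj_lo, h1']) (by rw [cosetWord_adj_hi, h0']), adj_smul_adj_smul, mul_add,
      ← mul_assoc, mul_comm (T (-1)) (T 1), T_mul_T_neg, one_mul]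
  · rw [klCoeff_peak_true h0 h1 h0' h1']; exact add_comm _ _
  · exact (klCoeff_peak_same h0 h1 (by rw [h0', h1'])).symm

lemma tl_klVec_peak (i : Fin (N - 1)) (y : Coset N K) (h0 : cosetWord y (lo i) = true)
    (h1 : cosetWord y (hi i) = false) : tl i (klVec y) = (T 1 + T (-1) : R) • klVec y := by
  rw [← tl_klVec i y h0 h1, tl_mul_self]

open Classical in
lemma klCoeff_eq (hK : K ≤ N) (y x : Coset N K) :
    klCoeff y x = if pathOf hK x ∈ flips (pathOf hK y)
      then T (-(dist (pathOf hK x) (pathOf hK y) : ℤ)) else 0 :=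
  coeff_eq (pathOf hK y) (pathOf hK x)

lemma pathLE_of_klCoeff_ne_zero (hK : K ≤ N) {y x : Coset N K} (h : klCoeff y x ≠ 0) :
    PathLE (pathOf hK x) (pathOf hK y) := by
  classical
  rw [klCoeff_eq hK] at h
  exact (ite_ne_right_iff.1 h).1.1

lemma self_mem_flips (β : Path N K) : β ∈ flips β :=
  ⟨fun _ => le_rfl, ∅, by simp, by simp⟩

lemma klCoeff_self (hK : K ≤ N) (y : Coset N K) : klCoeff y y = 1 := by
  rw [klCoeff_eq hK, if_pos (self_mem_flips _), ParabolicKL.dist]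
  simp

/-- A string without peak has the form `1…12…2`, and it has no pairings. -/
lemma klVec_of_no_peak (hK : K ≤ N) (y : Coset N K)
    (h : ∀ j : Fin (N - 1), cosetWord y (lo j) = true → cosetWord y (hi j) = true) :
    klVec y = m y := by
  classical
  have mono : ∀ i j : ℕ, i ≤ j → j < N → letter (cosetWord y) i = true →
      letter (cosetWord y) j = true := by
    intro i j hij hj hi
    induction j, hij using Nat.le_induction with
    | base => exact hi
    | succ j hij ih =>
      have := h ⟨j, by omega⟩ ((letter_mk (cosetWord y) (k := j) (by omega)).symm.trans
        (ih (by omega)))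
      rw [letter_mk _ hj]
      exact this
  ext1 x
  rw [klVec_apply, m_apply]
  split_ifs with hxy
  · rw [← hxy, klCoeff_self hK]
  · rw [klCoeff_eq hK, if_neg]
    rintro ⟨-, S, hS, hS'⟩
    apply hxy
    refine cosetWord_injective (funext fun k => (hS' k fun p hp => ?_).symm)
    have hp := (isPairing_iff _ _ _).1 (hS p hp).1
    have h1 := mono _ _ hp.1.le hp.2.1 hp.letter_left
    rw [show letter (cosetWord y) p.2 = false from hp.letter_right] at h1
    simp at h1

lemma cosetLength_adj_add_one {i : Fin (N - 1)} {y : Coset N K} (h0 : cosetWord y (lo i) = true)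
    (h1 : cosetWord y (hi i) = false) : cosetLength (adj i • y) + 1 = cosetLength y := by
  have h2 := cosetLength_lt i (adj i • y) (by rw [cosetWord_adj_lo, h1])
    (by rw [cosetWord_adj_hi, h0])
  have h3 := cosetLength_adj_le i (adj i • y)
  rw [adj_smul_adj_smul] at h2 h3
  omega

/-- The combinations of elements `C_γ` with `|γ| < n` and bar invariant coefficients. -/
def barSpan (N K n : ℕ) : AddSubgroup (M N K) :=
  AddSubgroup.closure {v | ∃ (p : R) (γ : Coset N K), invert p = p ∧ cosetLength γ < n ∧
    v = p • klVec γ}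

lemma smul_klVec_mem_barSpan {n : ℕ} {p : R} (hp : invert p = p) {γ : Coset N K}
    (hγ : cosetLength γ < n) : p • klVec γ ∈ barSpan N K n :=
  AddSubgroup.subset_closure ⟨p, γ, hp, hγ, rfl⟩

lemma klVec_mem_barSpan {n : ℕ} {γ : Coset N K} (hγ : cosetLength γ < n) :
    klVec γ ∈ barSpan N K n := by
  have := smul_klVec_mem_barSpan (p := 1) (map_one _) hγ
  rwa [one_smul] at this

lemma barSpan_mono {n k : ℕ} (h : n ≤ k) : barSpan N K n ≤ barSpan N K k := by
  apply AddSubgroup.closure_mono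
  rintro v ⟨p, γ, hp, hγ, rfl⟩
  exact ⟨p, γ, hp, hγ.trans_le h, rfl⟩

lemma smul_mem_barSpan {n : ℕ} {p : R} (hp : invert p = p) {v : M N K} (hv : v ∈ barSpan N K n) :
    p • v ∈ barSpan N K n := by
  induction hv using AddSubgroup.closure_induction with
  | mem v hv =>
    obtain ⟨q, γ, hq, hγ, rfl⟩ := hv
    rw [smul_smul]
    exact smul_klVec_mem_barSpan (by rw [map_mul, hp, hq]) hγ
  | zero => rw [smul_zero]; exact zero_mem _
  | add v w _ _ hv hw => rw [smul_add]; exact add_mem hv hw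
  | neg v _ hv => rw [smul_neg]; exact neg_mem hv

lemma invert_quantum_two : invert (T 1 + T (-1) : R) = T 1 + T (-1) := by
  rw [map_add, invert_T, invert_T, neg_neg, add_comm]

/-- If `y` has the same letter at the positions `i` and `i + 1`, then `(T_i + t⁻¹) C_y` is a
combination of smaller elements: a peak `j` of `y` is removed, and then `T_i + t⁻¹` is either
commuted with `T_j + t⁻¹`, or eliminated by the Temperley--Lieb relation. -/
lemma tl_klVec_same (hK : K ≤ N) (y : Coset N K) (i : Fin (N - 1))
    (h : cosetWord y (lo i) = cosetWord y (hi i)) :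
    tl i (klVec y) ∈ barSpan N K (cosetLength y) := by
  induction hn : cosetLength y using Nat.strong_induction_on generalizing y i with | _ n ih
  subst hn
  -- by the induction hypothesis, the operators raise the length by at most one
  have step : ∀ k ≤ cosetLength y, ∀ j : Fin (N - 1), ∀ v ∈ barSpan N K k,
      tl j v ∈ barSpan N K (k + 1) := by
    intro k hk j v hv
    induction hv using AddSubgroup.closure_induction with
    | mem v hv =>
      obtain ⟨q, γ, hq, hγ, rfl⟩ := hv
      rw [map_smul]
      apply smul_mem_barSpan hq
      cases h0 : cosetWord γ (lo j) <;> cases h1 : cosetWord γ (hi j)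
      · exact barSpan_mono (by omega) (ih _ (by omega) γ j (by rw [h0, h1]) rfl)
      · have := tl_klVec j (adj j • γ) (by rw [cosetWord_adj_lo, h1]) (by rw [cosetWord_adj_hi, h0])
        rw [adj_smul_adj_smul] at this
        rw [this]
        have := cosetLength_adj_le j γ
        exact klVec_mem_barSpan (by omega)
      · rw [tl_klVec_peak j γ h0 h1]
        exact smul_klVec_mem_barSpan invert_quantum_two (by omega)
      · exact barSpan_mono (by omega) (ih _ (by omega) γ j (by rw [h0, h1]) rfl)
    | zero => rw [map_zero]; exact zero_mem _
    | add v w _ _ hv hw => rw [map_add]; exact add_mem hv hw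
    | neg v _ hv => rw [map_neg]; exact neg_mem hv
  by_cases hp : ∀ j : Fin (N - 1), cosetWord y (lo j) = true → cosetWord y (hi j) = true
  · rw [klVec_of_no_peak hK y hp, tl_same i y h]
    exact zero_mem _
  push Not at hp
  obtain ⟨j, h0, h1⟩ := hp
  rw [ne_eq, Bool.not_eq_true] at h1
  have hlen := cosetLength_adj_add_one h0 h1
  -- a peak away from `i` survives the application of `T_i + t⁻¹`, which only produces elements
  -- shorter than `s_j y`
  have far : i.1 + 1 < j.1 ∨ j.1 + 1 < i.1 → tl i (klVec y) ∈ barSpan N K (cosetLength y) := by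
    intro hij
    have hc : tl i (klVec y) = tl j (tl i (klVec (adj j • y))) := by
      rw [← tl_klVec j y h0 h1]
      rcases hij with hij | hij
      · exact tl_comm i j hij _
      · exact (tl_comm j i hij _).symm
    rw [hc, ← hlen]
    refine step _ (by omega) j _ (ih _ (by omega) _ i ?_ rfl)
    rw [cosetWord_adj_of_ne, cosetWord_adj_of_ne, h] <;>
    simp only [lo, hi, ne_eq, Fin.ext_iff] <;> omega
  -- if the peak touches `i`, then `s_j y` has a peak at `i`, and `E_i E_j E_i = E_i` applies
  have near : i.1 + 1 = j.1 ∨ j.1 + 1 = i.1 → cosetWord (adj j • y) (lo i) = true →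
      cosetWord (adj j • y) (hi i) = false → tl i (klVec y) ∈ barSpan N K (cosetLength y) := by
    intro hij h2 h3
    have hr : (tl i * tl j * tl i : Module.End R (M N K)) = tl i := by
      rcases hij with hij | hij
      · exact (tl_mul_tl_mul_tl i j hij).1
      · exact (tl_mul_tl_mul_tl j i hij).2
    have := LinearMap.congr_fun hr (klVec (adj i • adj j • y))
    rw [Module.End.mul_apply, Module.End.mul_apply, tl_klVec i _ h2 h3, tl_klVec j y h0 h1] at this
    rw [this]
    exact klVec_mem_barSpan (by omega)
  rcases lt_trichotomy i.1 j.1 with hij | hij | hij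
  · rcases (Nat.succ_le_of_lt hij).eq_or_lt with hij | hij
    · have e : lo j = hi i := Fin.ext hij.symm
      refine near (Or.inl hij) ?_ ?_
      · rw [cosetWord_adj_of_ne, h, ← e, h0] <;>
        simp only [lo, hi, ne_eq, Fin.ext_iff] <;> omega
      · rw [← e, cosetWord_adj_lo, h1]
    · exact far (Or.inl hij)
  · rw [Fin.ext hij, h0, h1] at h
    simp at h
  · rcases (Nat.succ_le_of_lt hij).eq_or_lt with hij | hij
    · have e : lo i = hi j := Fin.ext hij.symm
      refine near (Or.inr hij) ?_ ?_
      · rw [e, cosetWord_adj_hi, h0]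
      · rw [cosetWord_adj_of_ne, ← h, e, h1] <;>
        simp only [lo, hi, ne_eq, Fin.ext_iff] <;> omega
    · exact far (Or.inr hij)

/-- The Temperley--Lieb operators preserve the bar invariant combinations of the `C_γ`. -/
lemma tl_klVec_mem (hK : K ≤ N) (y : Coset N K) (i : Fin (N - 1)) :
    ∃ n, tl i (klVec y) ∈ barSpan N K n := by
  cases h0 : cosetWord y (lo i) <;> cases h1 : cosetWord y (hi i)
  · exact ⟨_, tl_klVec_same hK y i (by rw [h0, h1])⟩
  · have := tl_klVec i (adj i • y) (by rw [cosetWord_adj_lo, h1]) (by rw [cosetWord_adj_hi, h0])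
    rw [adj_smul_adj_smul] at this
    rw [this]
    exact ⟨_, klVec_mem_barSpan (Nat.lt_succ_self _)⟩
  · rw [tl_klVec_peak i y h0 h1]
    exact ⟨_, smul_klVec_mem_barSpan invert_quantum_two (Nat.lt_succ_self _)⟩
  · exact ⟨_, tl_klVec_same hK y i (by rw [h0, h1])⟩

/-! ### The orders on cosets and paths -/

lemma cosetLE_adj {i : Fin (N - 1)} {x y : Coset N K} (h0 : cosetWord y (lo i) = true)
    (h1 : cosetWord y (hi i) = false) (h : CosetLE x (adj i • y)) : CosetLE x y := by
  obtain ⟨v, w, hv, hw, hvw⟩ := h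
  have hy : ((adj i * w : Equiv.Perm (Fin N)) : Coset N K) = y := by
    rw [← adj_smul_adj_smul i y, ← hw]; rfl
  refine ⟨v, adj i * w, hv, hy, hvw.tail ⟨⟨w⁻¹ (lo i), w⁻¹ (hi i), ?_, ?_⟩, ?_⟩⟩
  · exact fun e => lo_ne_hi i (w⁻¹.injective e)
  · rw [Equiv.mul_swap_eq_swap_mul, perm_apply_inv, perm_apply_inv]; rfl
  · have e : adj i * (adj i * w) = w := by rw [← mul_assoc, adj, Equiv.swap_mul_self, one_mul]
    have := length_adj_mul_lt i (adj i * w) ?_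
    · rwa [e] at this
    · rw [← hy, cosetWord_mk] at h0 h1
      simp only [word, decide_eq_false_iff_not, decide_eq_true_eq] at h0 h1
      rw [Fin.lt_def]; omega

lemma letter_pathOf_lo (hK : K ≤ N) (x : Coset N K) (i : Fin (N - 1)) :
    letter (pathOf hK x).1 i = cosetWord x (lo i) := letter_mk _ (by omega)

lemma letter_pathOf_hi (hK : K ≤ N) (x : Coset N K) (i : Fin (N - 1)) :
    letter (pathOf hK x).1 (i + 1) = cosetWord x (hi i) := letter_mk _ (by omega)

/-- Removing a peak changes the path only at the vertex of the peak. -/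
lemma height_adj (hK : K ≤ N) {i : Fin (N - 1)} {y : Coset N K} (h0 : cosetWord y (lo i) = true)
    (h1 : cosetWord y (hi i) = false) (k : ℕ) :
    height (pathOf hK (adj i • y)) k = height (pathOf hK y) k - if k = i + 1 then 2 else 0 := by
  have hoff : ∀ k, k < N → k ≠ i.1 → k ≠ i.1 + 1 →
      letter (pathOf hK (adj i • y)).1 k = letter (pathOf hK y).1 k := by
    intro k hk h2 h3
    rw [letter_mk _ hk, letter_mk _ hk]
    exact cosetWord_adj_of_ne i y _ (by simpa [lo, Fin.ext_iff]) (by simpa [hi, Fin.ext_iff])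
  induction k using Nat.strong_induction_on with | _ k ih
  rcases lt_or_ge N k with hk | hk
  · rw [height_of_le _ hk.le, height_of_le _ hk.le, if_neg (by omega), sub_zero]
  cases k with
  | zero => simp [height_zero]
  | succ k =>
    have hs := height_succ (pathOf hK (adj i • y)) hk
    have hs' := height_succ (pathOf hK y) hk
    by_cases e1 : k = i
    · subst e1
      rw [letter_pathOf_lo, cosetWord_adj_lo, h1] at hs
      rw [letter_pathOf_lo, h0] at hs'
      have := ih i (by omega)
      simp at this hs hs' ⊢
      omega
    by_cases e2 : k = i + 1
    · subst e2
      rw [letter_pathOf_hi, cosetWord_adj_hi, h0] at hs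
      rw [letter_pathOf_hi, h1] at hs'
      have := ih (i + 1) (by omega)
      simp at this hs hs' ⊢
      omega
    · rw [hoff k hk e1 e2] at hs
      have := ih k (by omega)
      rw [if_neg (by omega)] at this ⊢
      omega

/-- If a path lies below another one, it is obtained from it by successive removals of peaks, each
of which goes down in the Bruhat order. -/
lemma cosetLE_of_pathLE (hK : K ≤ N) (x y : Coset N K)
    (h : PathLE (pathOf hK x) (pathOf hK y)) :
    CosetLE x y ∧ (x = y ∨ cosetLength x < cosetLength y) := by
  induction hn : cosetLength y using Nat.strong_induction_on generalizing y with | _ n ih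
  subst hn
  by_cases hxy : x = y
  · subst hxy
    refine ⟨?_, Or.inl rfl⟩
    induction x using QuotientGroup.induction_on with | _ v
    exact ⟨v, v, rfl, rfl, Relation.ReflTransGen.refl⟩
  set α := pathOf hK x with hα
  set β := pathOf hK y with hβ
  have hne : ((Finset.range (N + 1)).filter fun k => height α k < height β k).Nonempty := by
    by_contra hne
    rw [Finset.not_nonempty_iff_eq_empty, Finset.filter_eq_empty_iff] at hne
    apply hxy
    apply (pathOf_bijective hK).1
    refine path_ext fun k hk => le_antisymm (h k) (not_lt.1 (hne ?_))
    rw [Finset.mem_range]; omega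
  -- the highest vertex of the upper path among those not on the lower path is a peak
  obtain ⟨k, hk, hmax⟩ := Finset.exists_max_image _ (fun k => height β k) hne
  simp only [Finset.mem_filter, Finset.mem_range] at hk hmax
  obtain ⟨hkN, hk⟩ := hk
  obtain ⟨k, rfl⟩ : ∃ k', k = k' + 1 := by
    cases k with
    | zero => simp [height_zero] at hk
    | succ k => exact ⟨k, rfl⟩
  have hkN' : k + 1 < N := by
    by_contra hlt
    rw [height_of_le α (by omega), height_of_le β (by omega)] at hk
    exact lt_irrefl _ hk
  have hev := even_height_sub α β (k + 1)
  have h2 : height α (k + 1) + 2 ≤ height β (k + 1) := by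
    obtain ⟨c, hc⟩ := hev; omega
  have hα0 := height_step α (show k < N by omega)
  have hα1 := height_step α hkN'
  have h0 : letter β.1 k = true := by
    rcases height_step β (show k < N by omega) with h3 | h3
    · exact h3.1
    · have := hmax k ⟨by omega, by omega⟩; omega
  have h1 : letter β.1 (k + 1) = false := by
    rcases height_step β hkN' with h3 | h3
    · have := hmax (k + 1 + 1) ⟨by omega, by omega⟩; omega
    · exact h3.1
  let i : Fin (N - 1) := ⟨k, by omega⟩
  have h0' : cosetWord y (lo i) = true := (letter_pathOf_lo hK y i).symm.trans h0
  have h1' : cosetWord y (hi i) = false := (letter_pathOf_hi hK y i).symm.trans h1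
  have hlen := cosetLength_adj_add_one h0' h1'
  have := ih _ (by omega) (adj i • y) (fun l => ?_) rfl
  · refine ⟨cosetLE_adj h0' h1' this.1, Or.inr ?_⟩
    rcases this.2 with h | h
    · rw [h]; omega
    · omega
  · rw [height_adj hK h0' h1']
    split_ifs with hl
    · rw [hl]
      change height α (k + 1) ≤ height β (k + 1) - 2
      omega
    · rw [sub_zero]; exact h l

/-! ### The bar involution of the module -/

lemma cosetLength_lt_of_klCoeff (hK : K ≤ N) {y x : Coset N K} (h : klCoeff y x ≠ 0)
    (hxy : x ≠ y) : cosetLength x < cosetLength y :=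
  (cosetLE_of_pathLE hK x y (pathLE_of_klCoeff_ne_zero hK h)).2.resolve_left hxy

lemma mem_of_forall_m {p : Submodule R (M N K)} {v : M N K} (h : ∀ x, v x ≠ 0 → m x ∈ p) :
    v ∈ p := by
  rw [← Finsupp.sum_single v]
  refine Submodule.sum_mem p fun x hx => ?_
  rw [single_eq_smul_m]
  exact p.smul_mem _ (h x (Finsupp.mem_support_iff.1 hx))

/-- The linear map `m_y ↦ C_y`. -/
def klMap (N K : ℕ) : M N K →ₗ[R] M N K := Finsupp.linearCombination R klVec

lemma klMap_m (y : Coset N K) : klMap N K (m y) = klVec y := by simp [klMap, m]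

/-- The family `C_y` is unitriangular, hence it is a basis. -/
lemma klMap_bijective (hK : K ≤ N) : Function.Bijective (klMap N K) := by
  classical
  have key : ∀ y, m y ∈ LinearMap.range (klMap N K) := by
    intro y
    induction hn : cosetLength y using Nat.strong_induction_on generalizing y with | _ n ih
    subst hn
    have h1 : klVec y - m y ∈ LinearMap.range (klMap N K) := by
      refine mem_of_forall_m fun x hx => ?_
      rw [Finsupp.sub_apply, klVec_apply, m_apply] at hx
      have hxy : x ≠ y := by
        rintro rfl
        rw [klCoeff_self hK, if_pos rfl, sub_self] at hx
        exact hx rfl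
      rw [if_neg hxy.symm, sub_zero] at hx
      exact ih _ (cosetLength_lt_of_klCoeff hK hx hxy) x rfl
    have h2 := sub_mem (LinearMap.mem_range_self (klMap N K) (m y)) h1
    rwa [klMap_m, sub_sub_cancel] at h2
  have hs : Function.Surjective (klMap N K) := fun v =>
    mem_of_forall_m (p := LinearMap.range (klMap N K)) fun x _ => key x
  exact ⟨OrzechProperty.injective_of_surjective_endomorphism _ hs, hs⟩

/-- The automorphism `m_y ↦ C_y` of the module. -/
def klLinearEquiv (hK : K ≤ N) : M N K ≃ₗ[R] M N K :=
  LinearEquiv.ofBijective (klMap N K) (klMap_bijective hK)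

lemma klLinearEquiv_m (hK : K ≤ N) (y : Coset N K) : klLinearEquiv hK (m y) = klVec y := klMap_m y

/-- The basis of the module formed by the vectors `C_y`. -/
def klBasis (hK : K ≤ N) : Module.Basis (Coset N K) R (M N K) :=
  Finsupp.basisSingleOne.map (klLinearEquiv hK)

lemma klBasis_apply (hK : K ≤ N) (y : Coset N K) : klBasis hK y = klVec y := by
  rw [klBasis, Module.Basis.map_apply, Finsupp.coe_basisSingleOne]
  exact klMap_m y

/-- Inverting `t` in all the coordinates. -/
def invertCoords (N K : ℕ) : M N K →+ M N K :=
  Finsupp.mapRange.addMonoidHom (invert (R := ℤ)).toRingEquiv.toRingHom.toAddMonoidHom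

lemma invertCoords_apply (v : M N K) (x : Coset N K) : invertCoords N K v x = invert (v x) := rfl

/-- The bar involution of the module: the semilinear map which fixes all the `C_y`. -/
def barM (hK : K ≤ N) : M N K →+ M N K :=
  ((klLinearEquiv hK).toLinearMap.toAddMonoidHom.comp (invertCoords N K)).comp
    (klLinearEquiv hK).symm.toLinearMap.toAddMonoidHom

lemma barM_apply (hK : K ≤ N) (v : M N K) :
    barM hK v = klLinearEquiv hK (invertCoords N K ((klLinearEquiv hK).symm v)) := rfl

lemma barM_smul (hK : K ≤ N) (p : R) (v : M N K) : barM hK (p • v) = invert p • barM hK v := by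
  have h : ∀ w : M N K, invertCoords N K (p • w) = invert p • invertCoords N K w := fun w => by
    ext1 x
    simp [invertCoords_apply]
  rw [barM_apply, barM_apply, map_smul, h, map_smul]

lemma barM_klVec (hK : K ≤ N) (y : Coset N K) : barM hK (klVec y) = klVec y := by
  classical
  rw [barM_apply, ← klLinearEquiv_m hK, LinearEquiv.symm_apply_apply]
  congr 1
  ext1 x
  rw [invertCoords_apply, m_apply]
  split_ifs <;> simp

lemma barM_of_mem_barSpan (hK : K ≤ N) {n : ℕ} {v : M N K} (hv : v ∈ barSpan N K n) :
    barM hK v = v := by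
  induction hv using AddSubgroup.closure_induction with
  | mem v hv =>
    obtain ⟨q, γ, hq, hγ, rfl⟩ := hv
    rw [barM_smul, hq, barM_klVec]
  | zero => exact map_zero _
  | add v w _ _ hv hw => rw [map_add, hv, hw]
  | neg v _ hv => rw [map_neg, hv]

lemma barM_tl (hK : K ≤ N) (i : Fin (N - 1)) (v : M N K) : barM hK (tl i v) = tl i (barM hK v) := by
  obtain ⟨v, rfl⟩ := (klLinearEquiv hK).surjective v
  induction v using Finsupp.induction_linear with
  | zero => simp
  | add v w hv hw => simp only [map_add, hv, hw]
  | single y c =>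
    obtain ⟨n, hn⟩ := tl_klVec_mem hK y i
    rw [single_eq_smul_m, map_smul, klLinearEquiv_m, map_smul, barM_smul, barM_smul, barM_klVec,
      barM_of_mem_barSpan hK hn, map_smul]

lemma barM_op (hK : K ≤ N) (i : Fin (N - 1)) (v : M N K) :
    barM hK (op i v) = rep N K (genInv i) (barM hK v) := by
  have h := barM_tl hK i v
  rw [tl_apply, tl_apply, map_add, barM_smul, invert_T, neg_neg] at h
  rw [genInv, map_sub, rep_gen, AlgHom.commutes, LinearMap.sub_apply, Module.algebraMap_end_apply,
    eq_sub_of_add_eq h]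
  module

lemma barM_rep (hK : K ≤ N) (h : Hecke N) (v : M N K) :
    barM hK (rep N K h v) = rep N K (bar N h) (barM hK v) := by
  obtain ⟨x, rfl⟩ := RingQuot.mkAlgHom_surjective R (HeckeRel N) h
  change barM hK (rep N K (proj N x) v) = rep N K (bar N (proj N x)) (barM hK v)
  induction x using FreeAlgebra.induction generalizing v with
  | grade0 r =>
    rw [AlgHom.commutes, bar_algebraMap, AlgHom.commutes, AlgHom.commutes,
      Module.algebraMap_end_apply, Module.algebraMap_end_apply, barM_smul]
  | grade1 i =>
    change barM hK (rep N K (gen i) v) = rep N K (bar N (gen i)) (barM hK v)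
    rw [rep_gen, bar_gen, barM_op]
  | mul x y hx hy =>
    simp only [map_mul, Module.End.mul_apply, hx, hy]
  | add x y hx hy =>
    simp only [map_add, LinearMap.add_apply, hx, hy]

lemma klVec_idCoset (hK : K ≤ N) : klVec (idCoset N K) = m (idCoset N K) := by
  refine klVec_of_no_peak hK _ fun j h => ?_
  rw [idCoset, cosetWord_mk] at h ⊢
  simp only [word, inv_one, Equiv.Perm.one_apply, decide_eq_true_eq, lo, hi] at h ⊢
  omega

lemma isBarInvolution_barM (hK : K ≤ N) : IsBarInvolution (barM hK : M N K → M N K) := by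
  intro h
  rw [phi_apply, barM_rep, ← klVec_idCoset hK, barM_klVec, klVec_idCoset hK, phi_apply]

/-- The range of `φ⁻` is a submodule for the Hecke algebra, and `m_{s_i x}` is a combination of
`m_x` and `T_i m_x`. -/
lemma m_adj_mem_range_phi (i : Fin (N - 1)) (x : Coset N K)
    (hx : m x ∈ LinearMap.range (phi N K)) : m (adj i • x) ∈ LinearMap.range (phi N K) := by
  have hop : op i (m x) ∈ LinearMap.range (phi N K) := by
    obtain ⟨h, hh⟩ := hx
    refine ⟨gen i * h, ?_⟩
    rw [phi_apply, map_mul, Module.End.mul_apply, ← phi_apply, hh, rep_gen]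
  cases h0 : cosetWord x (lo i) <;> cases h1 : cosetWord x (hi i)
  · rwa [adj_smul_eq i x (by rw [h0, h1])]
  · rwa [op_up i x h0 h1] at hop
  · rw [op_down i x h0 h1] at hop
    have := Submodule.sub_mem _ hop (Submodule.smul_mem _ (T 1 - T (-1) : R) hx)
    rwa [add_sub_cancel_left] at this
  · rwa [adj_smul_eq i x (by rw [h0, h1])]

lemma phi_surjective (hN : 0 < N) : Function.Surjective (phi N K) := by
  obtain ⟨n, rfl⟩ : ∃ n, N = n + 1 := ⟨N - 1, by omega⟩
  have key : ∀ v : Equiv.Perm (Fin (n + 1)),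
      m (v : Coset (n + 1) K) ∈ LinearMap.range (phi (n + 1) K) := by
    intro v
    have hv : v ∈ Submonoid.closure
        (Set.range fun i : Fin n ↦ Equiv.swap i.castSucc i.succ) := by
      rw [Equiv.Perm.mclosure_swap_castSucc_succ]; trivial
    induction hv using Submonoid.closure_induction_left with
    | one =>
      refine ⟨1, ?_⟩
      rw [phi_apply, map_one]; rfl
    | mul_left s hs v _ hv =>
      obtain ⟨i, rfl⟩ := hs
      exact m_adj_mem_range_phi (N := n + 1) (K := K) i _ hv
  intro v
  refine mem_of_forall_m (p := LinearMap.range (phi (n + 1) K)) fun x _ => ?_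
  induction x using QuotientGroup.induction_on with | _ v
  exact key v

lemma existsUnique_isBarInvolution (hN : 0 < N) (hK : K ≤ N) :
    ∃! b : M N K → M N K, IsBarInvolution b := by
  refine ⟨barM hK, isBarInvolution_barM hK, fun b hb => funext fun v => ?_⟩
  obtain ⟨h, rfl⟩ := phi_surjective hN v
  rw [hb h, isBarInvolution_barM hK h]

/-! ### The Kazhdan--Lusztig basis -/

lemma coeff_of_isNegative {p : R} (h : IsNegative p) (n : ℤ) (hn : 0 ≤ n) : p.coeff n = 0 := by
  obtain ⟨q, rfl⟩ := h
  rw [invert_apply, coeff_toLaurent]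
  rcases hn.eq_or_lt with rfl | hn
  · rw [neg_zero, show (0 : ℤ) = Nat.castEmbedding 0 from rfl,
      Finsupp.mapDomain_apply Nat.castEmbedding.injective]
    exact Polynomial.coeff_X_mul_zero q
  · rw [Finsupp.mapDomain_of_notMem_range]
    rintro ⟨k, hk⟩
    simp only [Nat.castEmbedding_apply] at hk
    omega

lemma isNegative_T {d : ℕ} (hd : d ≠ 0) : IsNegative (T (-(d : ℤ))) := by
  refine ⟨Polynomial.X ^ (d - 1), ?_⟩
  rw [← pow_succ', Nat.sub_add_cancel (Nat.pos_of_ne_zero hd), Polynomial.toLaurent_X_pow, invert_T]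

lemma eq_zero_of_invert_eq {p : R} (h : invert p = p) (hn : ∀ n : ℤ, 0 ≤ n → p.coeff n = 0) :
    p = 0 := by
  ext n
  rcases le_total 0 n with h0 | h0
  · rw [hn n h0]; rfl
  · rw [← h, invert_apply, hn _ (by omega)]; rfl

/-- A bar invariant vector with all coefficients in `t⁻¹ ℤ[t⁻¹]` vanishes: the coefficient of a
longest `C_y` is bar invariant and equal to the coefficient of `m_y`. -/
lemma eq_zero_of_barM_eq (hK : K ≤ N) {z : M N K} (hz : barM hK z = z)
    (hn : ∀ x, ∀ n : ℤ, 0 ≤ n → (z x).coeff n = 0) : z = 0 := by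
  obtain ⟨a, rfl⟩ := (klLinearEquiv hK).surjective z
  rw [barM_apply, LinearEquiv.symm_apply_apply] at hz
  have ha : ∀ y, invert (a y) = a y := fun y =>
    DFunLike.congr_fun ((klLinearEquiv hK).injective hz) y
  suffices h : a = 0 by rw [h, map_zero]
  by_contra hne
  obtain ⟨y, hy, hmax⟩ := Finset.exists_max_image a.support cosetLength
    (Finsupp.support_nonempty_iff.2 hne)
  have hzy : klLinearEquiv hK a y = a y := by
    change Finsupp.linearCombination R klVec a y = a y
    rw [Finsupp.linearCombination_apply, Finsupp.sum, Finset.sum_apply', Finset.sum_eq_single y]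
    · rw [Finsupp.smul_apply, klVec_apply, klCoeff_self hK, smul_eq_mul, mul_one]
    · intro x hx hxy
      rw [Finsupp.smul_apply, klVec_apply]
      by_cases h0 : klCoeff x y = 0
      · rw [h0, smul_zero]
      · exact absurd (hmax x hx) (not_le.2 (cosetLength_lt_of_klCoeff hK h0 hxy.symm))
    · exact fun h => absurd hy h
  exact Finsupp.mem_support_iff.1 hy (eq_zero_of_invert_eq (ha y) (hzy ▸ hn y))

lemma dist_ne_zero {α β : Path N K} (h : α ≠ β) : dist α β ≠ 0 := by
  intro h0
  have h1 := dist_eq_card α β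
  have h2 := card_filter_eq α β
  rw [h0] at h1
  rw [← h1] at h2
  have h1 := Finset.filter_eq_empty_iff.1 (Finset.card_eq_zero.1 h1.symm)
  have h2 := Finset.filter_eq_empty_iff.1 (Finset.card_eq_zero.1 h2.symm)
  refine h (Subtype.ext (funext fun i => ?_))
  have h1 := h1 (Finset.mem_univ i)
  have h2 := h2 (Finset.mem_univ i)
  cases hα : α.1 i <;> cases hβ : β.1 i
  · rfl
  · exact absurd ⟨hβ, hα⟩ h2
  · exact absurd ⟨hβ, hα⟩ h1
  · rfl

lemma isKLBasis_klBasis (hK : K ≤ N) : IsKLBasis (barM hK : M N K → M N K) (klBasis hK) where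
  bar_eq y := by rw [klBasis_apply, barM_klVec]
  triangular x y h := by
    rw [klBasis_apply, klVec_apply]
    by_contra h0
    exact h (cosetLE_of_pathLE hK x y (pathLE_of_klCoeff_ne_zero hK h0)).1
  diagonal x := by rw [klBasis_apply, klVec_apply, klCoeff_self hK]
  negative x y _ hxy := by
    classical
    rw [klBasis_apply, klVec_apply, klCoeff_eq hK]
    split_ifs
    · exact isNegative_T (dist_ne_zero fun h => hxy ((pathOf_bijective hK).1 h))
    · exact ⟨0, by rw [mul_zero, map_zero, map_zero]⟩

lemma IsKLBasis.eq_klBasis (hK : K ≤ N) {C : Module.Basis (Coset N K) R (M N K)}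
    (hC : IsKLBasis (barM hK : M N K → M N K) C) : C = klBasis hK := by
  refine Module.Basis.eq_of_apply_eq fun y => sub_eq_zero.1 (eq_zero_of_barM_eq hK ?_ ?_)
  · rw [map_sub, hC.bar_eq, (isKLBasis_klBasis hK).bar_eq]
  · intro x n hn
    have h0 := isKLBasis_klBasis hK
    rw [Finsupp.sub_apply]
    rcases eq_or_ne x y with rfl | hxy
    · rw [hC.diagonal, h0.diagonal, sub_self]; rfl
    by_cases hle : CosetLE x y
    · change (C y x).coeff n - (klBasis hK y x).coeff n = 0
      rw [coeff_of_isNegative (hC.negative x y hle hxy) n hn,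
        coeff_of_isNegative (h0.negative x y hle hxy) n hn, sub_self]
    · rw [hC.triangular x y hle, h0.triangular x y hle, sub_self]; rfl

open Classical in
lemma klPoly_klBasis (hK : K ≤ N) (α β : Path N K) :
    klPoly hK (klBasis hK) α β = if α ∈ flips β then T (-(dist α β : ℤ)) else 0 := by
  have h : ∀ γ : Path N K, pathOf hK ((pathEquiv hK).symm γ) = γ := (pathEquiv hK).apply_symm_apply
  rw [klPoly, klBasis_apply, klVec_apply, klCoeff_eq hK, h, h]

/-! ### Boxes and strips below a path -/

/-- The box in column `k` which is the `r`-th one (counted from `0`) below the path `β`. -/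
def box (β : Path N K) (k r : ℕ) : ℤ × ℤ := ((k : ℤ), height β k - 2 * r - 1)

lemma box_inj {β : Path N K} {k r k' r' : ℕ} : box β k r = box β k' r' ↔ k = k' ∧ r = r' := by
  simp only [box, Prod.mk.injEq, Nat.cast_inj]
  constructor
  · rintro ⟨rfl, h⟩; exact ⟨rfl, by omega⟩
  · rintro ⟨rfl, rfl⟩; exact ⟨rfl, rfl⟩

lemma mem_region_iff (α β : Path N K) (c : ℤ × ℤ) :
    c ∈ region α β ↔ ∃ k r : ℕ, k ≤ N ∧ c = box β k r ∧
      2 * (r : ℤ) + 2 ≤ height β k - height α k := by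
  simp only [region, Finset.mem_biUnion, Finset.mem_range, Finset.mem_image, Finset.mem_filter,
    Finset.mem_Ioo]
  constructor
  · rintro ⟨k, hk, y, ⟨⟨h1, h2⟩, h3⟩, rfl⟩
    have h4 := even_height_add β (k := k) (by omega)
    have h5 := even_height_add α (k := k) (by omega)
    obtain ⟨a, ha⟩ := h3
    obtain ⟨b, hb⟩ := h4
    obtain ⟨d, hd⟩ := h5
    refine ⟨k, ((height β k - y - 1) / 2).toNat, by omega, ?_, by omega⟩
    rw [box, Prod.mk.injEq]
    exact ⟨rfl, by omega⟩
  · rintro ⟨k, r, hk, rfl, h⟩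
    obtain ⟨b, hb⟩ := even_height_add β hk
    refine ⟨k, by omega, _, ⟨⟨by omega, by omega⟩, ?_⟩, rfl⟩
    exact ⟨b - r - 1, by omega⟩

lemma box_mem_region {α β : Path N K} {k r : ℕ} :
    box β k r ∈ region α β ↔ k ≤ N ∧ 2 * (r : ℤ) + 2 ≤ height β k - height α k := by
  rw [mem_region_iff]
  constructor
  · rintro ⟨k', r', h1, h2, h3⟩
    obtain ⟨rfl, rfl⟩ := box_inj.1 h2
    exact ⟨h1, h3⟩
  · exact fun h => ⟨k, r, h.1, rfl, h.2⟩

lemma pos_and_lt_of_box_mem {α β : Path N K} {k r : ℕ} (h : box β k r ∈ region α β) :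
    0 < k ∧ k < N := by
  obtain ⟨h1, h2⟩ := box_mem_region.1 h
  constructor
  · rcases Nat.eq_zero_or_pos k with rfl | h3
    · rw [height_zero, height_zero] at h2; omega
    · exact h3
  · rcases h1.eq_or_lt with rfl | h3
    · rw [height_of_le α le_rfl, height_of_le β le_rfl] at h2; omega
    · exact h3

lemma above_mem (β : Path N K) (k r : ℕ) : box β k r ∈ upperNeighbors (box β k (r + 1)) := by
  simp only [upperNeighbors, box, Finset.mem_insert, Prod.mk.injEq]
  left; push_cast; exact ⟨trivial, by ring⟩

lemma nw_mem_of_false (β : Path N K) {k : ℕ} (hk : k < N) (h : letter β.1 k = false) (r : ℕ) :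
    box β k r ∈ upperNeighbors (box β (k + 1) r) := by
  have := height_succ_false β hk h
  simp only [upperNeighbors, box, Finset.mem_insert, Prod.mk.injEq]
  right; left; push_cast; exact ⟨by ring, by omega⟩

lemma nw_mem_of_true (β : Path N K) {k : ℕ} (hk : k < N) (h : letter β.1 k = true) (r : ℕ) :
    box β k r ∈ upperNeighbors (box β (k + 1) (r + 1)) := by
  have := height_succ_true β hk h
  simp only [upperNeighbors, box, Finset.mem_insert, Prod.mk.injEq]
  right; left; push_cast; exact ⟨by ring, by omega⟩

lemma ne_mem_of_true (β : Path N K) {k : ℕ} (hk : k < N) (h : letter β.1 k = true) (r : ℕ) :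
    box β (k + 1) r ∈ upperNeighbors (box β k r) := by
  have := height_succ_true β hk h
  simp only [upperNeighbors, box, Finset.mem_insert, Finset.mem_singleton, Prod.mk.injEq]
  right; right; push_cast; exact ⟨by ring, by omega⟩

lemma ne_mem_of_false (β : Path N K) {k : ℕ} (hk : k < N) (h : letter β.1 k = false) (r : ℕ) :
    box β (k + 1) r ∈ upperNeighbors (box β k (r + 1)) := by
  have := height_succ_false β hk h
  simp only [upperNeighbors, box, Finset.mem_insert, Finset.mem_singleton, Prod.mk.injEq]
  right; right; push_cast; exact ⟨by ring, by omega⟩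

/-- The boxes at depth `r` below the part of `β` over the pairing `(i, j)`. -/
def stripAt (β : Path N K) (r i j : ℕ) : Finset (ℤ × ℤ) :=
  (Finset.Icc (i + 1) j).image fun k => box β k r

lemma mem_stripAt {β : Path N K} {r i j : ℕ} {c : ℤ × ℤ} :
    c ∈ stripAt β r i j ↔ ∃ k, i < k ∧ k ≤ j ∧ c = box β k r := by
  simp only [stripAt, Finset.mem_image, Finset.mem_Icc, Nat.succ_le_iff, and_assoc, eq_comm]

lemma box_mem_stripAt {β : Path N K} {r i j k r' : ℕ} :
    box β k r' ∈ stripAt β r i j ↔ i < k ∧ k ≤ j ∧ r' = r := by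
  rw [mem_stripAt]
  constructor
  · rintro ⟨k', h1, h2, h3⟩
    obtain ⟨rfl, rfl⟩ := box_inj.1 h3
    exact ⟨h1, h2, rfl⟩
  · rintro ⟨h1, h2, rfl⟩
    exact ⟨k, h1, h2, rfl⟩

/-- A Dyck strip has at most one box in each column. -/
lemma IsDyckStrip.eq_of_fst_eq {D : Finset (ℤ × ℤ)} (h : IsDyckStrip D) {c c' : ℤ × ℤ}
    (hc : c ∈ D) (hc' : c' ∈ D) (he : c.1 = c'.1) : c = c' := by
  obtain ⟨x, l, p, -, -, -, rfl⟩ := h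
  simp only [Finset.mem_image] at hc hc'
  obtain ⟨k, -, rfl⟩ := hc
  obtain ⟨k', -, rfl⟩ := hc'
  simp only at he
  obtain rfl : k = k' := by omega
  rfl

/-- A Dyck strip all of whose boxes have depth `r` and which cannot be prolonged at depth `r` to
the left along a down step or to the right along an up step runs along a pairing. -/
lemma exists_stripAt {α β : Path N K} {D : Finset (ℤ × ℤ)} (hD : IsDyckStrip D)
    (hsub : D ⊆ region α β) {r : ℕ} (hr : ∀ k s, box β k s ∈ D → s = r)
    (hL : ∀ k, k < N → letter β.1 k = false → box β (k + 1) r ∈ D → box β k r ∈ D)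
    (hR : ∀ k, k < N → letter β.1 k = true → box β k r ∈ D → box β (k + 1) r ∈ D) :
    ∃ i j, Paired β i j ∧ D = stripAt β r i j := by
  obtain ⟨x, l, p, -, hp0, hp1, rfl⟩ := hD
  have hbox : ∀ k ≤ 2 * l, ∃ n : ℕ, (n : ℤ) = x + k ∧ p k = height β n - 2 * r - 1 ∧
      0 < n ∧ n < N := by
    intro k hk
    have hm : (x + (k : ℤ), p k) ∈ (Finset.range (2 * l + 1)).image
        fun k : ℕ => (x + (k : ℤ), p k) :=
      Finset.mem_image_of_mem _ (Finset.mem_range.2 (by omega))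
    have hm' := hsub hm
    obtain ⟨n, s, -, h2, -⟩ := (mem_region_iff _ _ _).1 hm'
    rw [h2] at hm hm'
    obtain rfl := hr n s hm
    have := pos_and_lt_of_box_mem hm'
    simp only [box, Prod.mk.injEq] at h2
    exact ⟨n, h2.1.symm, h2.2, this⟩
  obtain ⟨X, hX, hpX, hX0, hXN⟩ := hbox 0 (by omega)
  obtain ⟨i, rfl⟩ : ∃ i, X = i + 1 := ⟨X - 1, by omega⟩
  have hx : x = i + 1 := by push_cast at hX; omega
  subst hx
  have hp : ∀ k ≤ 2 * l, p k = height β (i + 1 + k) - 2 * r - 1 ∧ i + 1 + k < N := by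
    intro k hk
    obtain ⟨n, h1, h2, h3⟩ := hbox k hk
    obtain rfl : n = i + 1 + k := by omega
    exact ⟨h2, h3.2⟩
  have hset : (Finset.range (2 * l + 1)).image (fun k : ℕ => ((i : ℤ) + 1 + (k : ℤ), p k)) =
      stripAt β r i (i + 1 + 2 * l) := by
    ext c
    rw [mem_stripAt, Finset.mem_image]
    constructor
    · rintro ⟨k, hk, rfl⟩
      rw [Finset.mem_range] at hk
      refine ⟨i + 1 + k, by omega, by omega, ?_⟩
      rw [(hp k (by omega)).1, box]; push_cast; rfl
    · rintro ⟨k, h1, h2, rfl⟩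
      obtain ⟨k, rfl⟩ : ∃ k', k = i + 1 + k' := ⟨k - (i + 1), by omega⟩
      refine ⟨k, Finset.mem_range.2 (by omega), ?_⟩
      rw [(hp k (by omega)).1, box]; push_cast; rfl
  rw [hset] at hL hR
  have hlast := hp (2 * l) le_rfl
  have h0 := hp 0 (by omega)
  rw [add_zero] at h0
  have hleft : letter β.1 i = true := by
    by_contra h
    rw [Bool.not_eq_true] at h
    have := hL i (by omega) h (box_mem_stripAt.2 ⟨by omega, by omega, rfl⟩)
    have := (box_mem_stripAt.1 this).1
    omega
  have hright : letter β.1 (i + 1 + 2 * l) = false := by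
    by_contra h
    rw [Bool.not_eq_false] at h
    have := hR _ hlast.2 h (box_mem_stripAt.2 ⟨by omega, by omega, rfl⟩)
    have := (box_mem_stripAt.1 this).2.1
    omega
  have hl := height_succ_true β (show i < N by omega) hleft
  have hr' := height_succ_false β hlast.2 hright
  refine ⟨i, i + 1 + 2 * l, ⟨by omega, hlast.2, by omega, fun k h1 h2 => ?_⟩, hset⟩
  obtain ⟨k, rfl⟩ : ∃ k', k = i + 1 + k' := ⟨k - (i + 1), by omega⟩
  have := hp0 k (by omega)
  have := hp k (by omega)
  omega

/-! ### Configurations satisfying Rule II come from flips -/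

section Tiling

/-- `𝒟` is a tiling of the region between `α` and `β` by Dyck strips satisfying Rule II. -/
structure IsTiling (α β : Path N K) (𝒟 : Finset (Finset (ℤ × ℤ))) : Prop where
  isDyckStrip : ∀ D ∈ 𝒟, IsDyckStrip D
  disjoint : ∀ D ∈ 𝒟, ∀ D' ∈ 𝒟, D ≠ D' → Disjoint D D'
  biUnion : 𝒟.biUnion id = region α β
  rule : ∀ D ∈ 𝒟, ∀ D' ∈ 𝒟, D ≠ D' → RuleII D D'

lemma mem_confII (α β : Path N K) (𝒟 : Finset (Finset (ℤ × ℤ))) :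
    𝒟 ∈ ConfII α β ↔ IsTiling α β 𝒟 := by
  classical
  rw [ConfII, Conf, Finset.mem_filter, Finset.mem_filter]
  constructor
  · rintro ⟨⟨-, h1, h2, h3⟩, h4⟩
    exact ⟨h1, h2, h3, h4⟩
  · rintro ⟨h1, h2, h3, h4⟩
    refine ⟨⟨?_, h1, h2, h3⟩, h4⟩
    rw [Finset.mem_powerset]
    intro D hD
    rw [Finset.mem_powerset, ← h3]
    exact Finset.subset_biUnion_of_mem id hD

variable {α β : Path N K} {𝒟 : Finset (Finset (ℤ × ℤ))}

namespace IsTiling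

lemma subset_region (h : IsTiling α β 𝒟) {D : Finset (ℤ × ℤ)} (hD : D ∈ 𝒟) : D ⊆ region α β := by
  rw [← h.biUnion]
  exact Finset.subset_biUnion_of_mem id hD

lemma exists_mem (h : IsTiling α β 𝒟) {c : ℤ × ℤ} (hc : c ∈ region α β) : ∃ D ∈ 𝒟, c ∈ D := by
  rw [← h.biUnion, Finset.mem_biUnion] at hc
  exact hc

lemma eq_of_mem (h : IsTiling α β 𝒟) {D D' : Finset (ℤ × ℤ)} (hD : D ∈ 𝒟) (hD' : D' ∈ 𝒟)
    {c : ℤ × ℤ} (hc : c ∈ D) (hc' : c ∈ D') : D = D' := by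
  by_contra hne
  exact Finset.disjoint_left.1 (h.disjoint D hD D' hD' hne) hc hc'

lemma depth_unique (h : IsTiling α β 𝒟) {D : Finset (ℤ × ℤ)} (hD : D ∈ 𝒟) {k r s : ℕ}
    (h1 : box β k r ∈ D) (h2 : box β k s ∈ D) : r = s :=
  (box_inj.1 ((h.isDyckStrip D hD).eq_of_fst_eq h1 h2 rfl)).2

/-- The shape of a strip which contains a box at depth `0`: since the box above it lies outside the
region, Rule II forbids any strip on top of it. -/
lemma shape_zero (h : IsTiling α β 𝒟) {D : Finset (ℤ × ℤ)} (hD : D ∈ 𝒟) {k : ℕ}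
    (hk : box β k 0 ∈ D) : ∃ i j, Paired β i j ∧ D = stripAt β 0 i j := by
  have hup : ∀ c ∈ D, ∀ u ∈ upperNeighbors c, u ∈ region α β → u ∈ D := by
    intro c hc u hu hur
    by_contra huD
    obtain ⟨D', hD', huD'⟩ := h.exists_mem hur
    have hne : D ≠ D' := by rintro rfl; exact huD huD'
    have hsub := h.rule D hD D' hD' hne ⟨c, hc, u, huD', hu⟩ _ hk
    have hm : ((k : ℤ), height β k + 1) ∈ region α β := by
      have : ((k : ℤ), height β k + 1) ∈ D ∪ D' := hsub (by
        simp only [upperNeighbors, box, Finset.mem_insert, Prod.mk.injEq]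
        left; push_cast; exact ⟨trivial, by ring⟩)
      rcases Finset.mem_union.1 this with h1 | h1
      · exact h.subset_region hD h1
      · exact h.subset_region hD' h1
    obtain ⟨k', r, -, h2, -⟩ := (mem_region_iff _ _ _).1 hm
    simp only [box, Prod.mk.injEq, Nat.cast_inj] at h2
    obtain ⟨rfl, h2⟩ := h2
    omega
  have hr : ∀ k s, box β k s ∈ D → s = 0 := by
    intro k s hs
    cases s with
    | zero => rfl
    | succ s =>
      have h1 := box_mem_region.1 (h.subset_region hD hs)
      have h2 := hup _ hs _ (above_mem β k s) (box_mem_region.2 ⟨h1.1, by push_cast at h1; omega⟩)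
      exact absurd (h.depth_unique hD hs h2) (by omega)
  refine exists_stripAt (h.isDyckStrip D hD) (h.subset_region hD) hr ?_ ?_
  · intro k hkN hl hm
    refine hup _ hm _ (nw_mem_of_false β hkN hl 0) (box_mem_region.2 ⟨hkN.le, ?_⟩)
    have h1 := (box_mem_region.1 (h.subset_region hD hm)).2
    have h2 := height_succ_false β hkN hl
    rcases height_step α hkN with h3 | h3 <;> omega
  · intro k hkN hl hm
    refine hup _ hm _ (ne_mem_of_true β hkN hl 0) (box_mem_region.2 ⟨hkN, ?_⟩)
    have h1 := (box_mem_region.1 (h.subset_region hD hm)).2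
    have h2 := height_succ_true β hkN hl
    rcases height_step α hkN with h3 | h3 <;> omega

/-- The shape of a strip which contains a box below a strip of known shape: by Rule II, it is
covered by this strip. -/
lemma shape_succ (h : IsTiling α β 𝒟) {D : Finset (ℤ × ℤ)} (hD : D ∈ 𝒟) {k r i' j' : ℕ}
    (hk : box β k (r + 1) ∈ D) (hD' : stripAt β r i' j' ∈ 𝒟) (hk' : box β k r ∈ stripAt β r i' j') :
    ∃ i j, Paired β i j ∧ D = stripAt β (r + 1) i j ∧ i' < i ∧ j < j' := by
  have hne : D ≠ stripAt β r i' j' := by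
    intro e
    rw [← e] at hk'
    exact absurd (h.depth_unique hD hk hk') (by omega)
  have hup := h.rule D hD _ hD' hne ⟨_, hk, _, hk', above_mem β k r⟩
  have hr : ∀ k s, box β k s ∈ D → s = r + 1 := by
    intro k s hs
    have habove : ((k : ℤ), height β k - 2 * s + 1) ∈ upperNeighbors (box β k s) := by
      simp only [upperNeighbors, box, Finset.mem_insert, Prod.mk.injEq]
      left; exact ⟨trivial, by ring⟩
    rcases Finset.mem_union.1 (hup _ hs habove) with h1 | h1
    · have := congrArg Prod.snd ((h.isDyckStrip D hD).eq_of_fst_eq hs h1 rfl)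
      simp only [box] at this
      omega
    · obtain ⟨k', -, -, h2⟩ := mem_stripAt.1 h1
      simp only [box, Prod.mk.injEq, Nat.cast_inj] at h2
      obtain ⟨rfl, h2⟩ := h2
      omega
  have hsame : ∀ c ∈ D, ∀ k, box β k (r + 1) ∈ upperNeighbors c → box β k (r + 1) ∈ D := by
    intro c hc k hu
    rcases Finset.mem_union.1 (hup _ hc hu) with h1 | h1
    · exact h1
    · exact absurd (box_mem_stripAt.1 h1).2.2 (by omega)
  have hprev : ∀ c ∈ D, ∀ k, box β k r ∈ upperNeighbors c → i' < k ∧ k ≤ j' := by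
    intro c hc k hu
    rcases Finset.mem_union.1 (hup _ hc hu) with h1 | h1
    · exact absurd (hr _ _ h1) (by omega)
    · exact ⟨(box_mem_stripAt.1 h1).1, (box_mem_stripAt.1 h1).2.1⟩
  obtain ⟨i, j, hij, rfl⟩ := exists_stripAt (h.isDyckStrip D hD) (h.subset_region hD) hr
    (fun k hkN hl hm => hsame _ hm _ (nw_mem_of_false β hkN hl _))
    (fun k hkN hl hm => hsame _ hm _ (ne_mem_of_true β hkN hl _))
  have hij1 := hij.1
  have hij2 := hij.2.1
  refine ⟨i, j, hij, rfl, ?_, ?_⟩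
  · exact (hprev _ (box_mem_stripAt.2 ⟨by omega, by omega, rfl⟩) _
      (nw_mem_of_true β (by omega) hij.letter_left r)).1
  · have := (hprev _ (box_mem_stripAt.2 ⟨hij1, le_rfl, rfl⟩) _
      (ne_mem_of_false β hij2 hij.letter_right r)).2
    omega

/-- The strips of a tiling run along pairings of `β` at constant depth, and a strip at positive
depth is covered by a strip along a larger pairing. -/
lemma shape (h : IsTiling α β 𝒟) (r : ℕ) {D : Finset (ℤ × ℤ)} (hD : D ∈ 𝒟) {k : ℕ}
    (hk : box β k r ∈ D) : ∃ i j, Paired β i j ∧ D = stripAt β r i j ∧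
      ∀ s, r = s + 1 → ∃ i' j', stripAt β s i' j' ∈ 𝒟 ∧ i' < i ∧ j < j' := by
  induction r generalizing D k with
  | zero =>
    obtain ⟨i, j, h1, h2⟩ := h.shape_zero hD hk
    exact ⟨i, j, h1, h2, fun s hs => by omega⟩
  | succ r ih =>
    have h1 := box_mem_region.1 (h.subset_region hD hk)
    obtain ⟨D', hD', hk'⟩ := h.exists_mem (c := box β k r)
      (box_mem_region.2 ⟨h1.1, by push_cast at h1; omega⟩)
    obtain ⟨i', j', -, rfl, -⟩ := ih hD' hk'
    obtain ⟨i, j, h2, h3, h4, h5⟩ := h.shape_succ hD hk hD' hk'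
    refine ⟨i, j, h2, h3, fun s hs => ?_⟩
    obtain rfl : r = s := by omega
    exact ⟨i', j', hD', h4, h5⟩

/-- Every box of the region lies in a strip along a pairing. -/
lemma exists_stripAt_mem (h : IsTiling α β 𝒟) {k r : ℕ} (hk : box β k r ∈ region α β) :
    ∃ i j, Paired β i j ∧ stripAt β r i j ∈ 𝒟 ∧ i < k ∧ k ≤ j := by
  obtain ⟨D, hD, hkD⟩ := h.exists_mem hk
  obtain ⟨i, j, h1, rfl, -⟩ := h.shape r hD hkD
  have := box_mem_stripAt.1 hkD
  exact ⟨i, j, h1, hD, this.1, this.2.1⟩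

/-- The first box of a strip is the lowest one in its column: a box below it would lie in a strip
along a strictly smaller pairing, which does not reach this column. -/
lemma depth_eq (h : IsTiling α β 𝒟) {r i j : ℕ} (hij : Paired β i j) (hD : stripAt β r i j ∈ 𝒟) :
    height β (i + 1) - height α (i + 1) = 2 * (r : ℤ) + 2 := by
  have hij1 := hij.1
  have hm : box β (i + 1) r ∈ stripAt β r i j := box_mem_stripAt.2 ⟨by omega, by omega, rfl⟩
  have h1 := box_mem_region.1 (h.subset_region hD hm)
  by_contra hne
  have hev := even_height_sub α β (i + 1)
  have h2 : box β (i + 1) (r + 1) ∈ region α β := by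
    obtain ⟨c, hc⟩ := hev
    exact box_mem_region.2 ⟨h1.1, by push_cast; omega⟩
  obtain ⟨D₂, hD₂, hk₂⟩ := h.exists_mem h2
  obtain ⟨i₂, j₂, -, rfl, h3⟩ := h.shape (r + 1) hD₂ hk₂
  obtain ⟨i₃, j₃, hD₃, h4, h5⟩ := h3 r rfl
  have h6 := box_mem_stripAt.1 hk₂
  have h7 := h.eq_of_mem hD₃ hD (box_mem_stripAt.2 ⟨by omega, by omega, rfl⟩) hm
  have h8 : box β (i₃ + 1) r ∈ stripAt β r i j := by
    rw [← h7]; exact box_mem_stripAt.2 ⟨by omega, by omega, rfl⟩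
  have := (box_mem_stripAt.1 h8).1
  omega

/-- The lower path goes down where a strip starts: otherwise the box to the left, at the same depth,
would belong to the region and hence to the same strip. -/
lemma letter_left (h : IsTiling α β 𝒟) {r i j : ℕ} (hij : Paired β i j)
    (hD : stripAt β r i j ∈ 𝒟) : letter α.1 i = false := by
  have hij1 := hij.1
  have hij2 := hij.2.1
  by_contra hl
  rw [Bool.not_eq_false] at hl
  have h1 := height_succ_true α (k := i) (by omega) hl
  have h2 := height_succ_true β (k := i) (by omega) hij.letter_left
  have h3 := h.depth_eq hij hD
  obtain ⟨i₂, j₂, hij', hD', h4, h5⟩ := h.exists_stripAt_mem (k := i) (r := r)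
    (box_mem_region.2 ⟨by omega, by omega⟩)
  have h6 : i ≠ j₂ := by
    rintro rfl
    have := hij'.letter_right
    rw [hij.letter_left] at this
    simp at this
  have h7 := h.eq_of_mem hD' hD (c := box β (i + 1) r)
    (box_mem_stripAt.2 ⟨by omega, by omega, rfl⟩) (box_mem_stripAt.2 ⟨by omega, by omega, rfl⟩)
  have h8 : box β i r ∈ stripAt β r i j := by
    rw [← h7]; exact box_mem_stripAt.2 ⟨by omega, by omega, rfl⟩
  have := (box_mem_stripAt.1 h8).1
  omega

/-- The lower path goes up where a strip ends, by the mirror image of the argument for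
`letter_left`. -/
lemma letter_right (h : IsTiling α β 𝒟) {r i j : ℕ} (hij : Paired β i j)
    (hD : stripAt β r i j ∈ 𝒟) : letter α.1 j = true := by
  have hij1 := hij.1
  have hij2 := hij.2.1
  by_contra hl
  rw [Bool.not_eq_true] at hl
  have h1 := height_succ_false α (k := j) (by omega) hl
  have h2 := height_succ_false β (k := j) (by omega) hij.letter_right
  have hm : box β j r ∈ stripAt β r i j := box_mem_stripAt.2 ⟨by omega, by omega, rfl⟩
  have h3 := (box_mem_region.1 (h.subset_region hD hm)).2
  obtain ⟨i₂, j₂, hij', hD', h4, h5⟩ := h.exists_stripAt_mem (k := j + 1) (r := r)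
    (box_mem_region.2 ⟨by omega, by omega⟩)
  have h6 : i₂ ≠ j := by
    rintro rfl
    have := hij'.letter_left
    rw [hij.letter_right] at this
    simp at this
  have h7 := h.eq_of_mem hD' hD (box_mem_stripAt.2 ⟨by omega, by omega, rfl⟩) hm
  have h8 : box β (j + 1) r ∈ stripAt β r i j := by
    rw [← h7]; exact box_mem_stripAt.2 ⟨by omega, by omega, rfl⟩
  have := (box_mem_stripAt.1 h8).2.1
  omega

/-- A step of `β` which is turned from up to down starts a strip. -/
lemma exists_right (h : IsTiling α β 𝒟) (hle : PathLE α β) {k : ℕ} (hk : k < N)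
    (hβ : letter β.1 k = true) (hα : letter α.1 k = false) :
    ∃ j r, Paired β k j ∧ stripAt β r k j ∈ 𝒟 := by
  have h1 := height_succ_true β hk hβ
  have h2 := height_succ_false α hk hα
  have h3 := hle k
  obtain ⟨c, hc⟩ := even_height_sub α β k
  obtain ⟨r, rfl⟩ : ∃ r : ℕ, c = r := ⟨c.toNat, by omega⟩
  obtain ⟨i, j, hij, hD, h4, h5⟩ := h.exists_stripAt_mem (k := k + 1) (r := r)
    (box_mem_region.2 ⟨hk, by omega⟩)
  rcases (Nat.le_of_lt_succ h4).eq_or_lt with rfl | h6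
  · exact ⟨j, r, hij, hD⟩
  · have := (box_mem_region.1 (h.subset_region hD
      (box_mem_stripAt.2 (⟨h6, by omega, rfl⟩ : i < k ∧ k ≤ j ∧ r = r)))).2
    omega

/-- A step of `β` which is turned from down to up ends a strip. -/
lemma exists_left (h : IsTiling α β 𝒟) (hle : PathLE α β) {k : ℕ} (hk : k < N)
    (hβ : letter β.1 k = false) (hα : letter α.1 k = true) :
    ∃ i r, Paired β i k ∧ stripAt β r i k ∈ 𝒟 := by
  have h1 := height_succ_false β hk hβ
  have h2 := height_succ_true α hk hα
  have h3 := hle (k + 1)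
  obtain ⟨c, hc⟩ := even_height_sub α β (k + 1)
  obtain ⟨r, rfl⟩ : ∃ r : ℕ, c = r := ⟨c.toNat, by omega⟩
  obtain ⟨i, j, hij, hD, h4, h5⟩ := h.exists_stripAt_mem (k := k) (r := r)
    (box_mem_region.2 ⟨hk.le, by omega⟩)
  rcases h5.eq_or_lt with rfl | h6
  · exact ⟨i, r, hij, hD⟩
  · have := (box_mem_region.1 (h.subset_region hD
      (box_mem_stripAt.2 (⟨by omega, h6, rfl⟩ : i < k + 1 ∧ k + 1 ≤ j ∧ r = r)))).2
    omega

lemma mem_flips (h : IsTiling α β 𝒟) (hle : PathLE α β) : α ∈ flips β := by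
  refine ⟨hle, {p | IsPairing β p.1 p.2 ∧ ∃ r, stripAt β r p.1 p.2 ∈ 𝒟}, ?_, ?_⟩
  · rintro ⟨i, j⟩ ⟨hp, r, hr⟩
    have hij := (isPairing_iff _ _ _).1 hp
    refine ⟨hp, ?_, ?_⟩
    · rw [← letter_val α.1]; exact h.letter_left hij hr
    · rw [← letter_val α.1]; exact h.letter_right hij hr
  · intro k hk
    rw [← letter_val α.1, ← letter_val β.1]
    cases hα : letter α.1 k <;> cases hβ : letter β.1 k
    · rfl
    · obtain ⟨j, r, hij, hD⟩ := h.exists_right hle k.2 hβ hα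
      exact absurd rfl (hk (k, ⟨j, hij.2.1⟩) ⟨(isPairing_iff _ _ _).2 hij, r, hD⟩).1
    · obtain ⟨i, r, hij, hD⟩ := h.exists_left hle k.2 hβ hα
      exact absurd rfl (hk (⟨i, hij.1.trans hij.2.1⟩, k) ⟨(isPairing_iff _ _ _).2 hij, r, hD⟩).2
    · rfl

end IsTiling

end Tiling

variable {α β : Path N K}

/-! ### The configuration of a flip -/

/-- Half the vertical distance between the paths at the vertex `k`: the number of flipped pairings
around it. -/
def gap (β α : Path N K) (k : ℕ) : ℕ := (flags β α k).count false

/-- `(i, j)` is a pairing of `β` which is flipped in `α`. -/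
def Flipped (β α : Path N K) (i j : ℕ) : Prop := Paired β i j ∧ letter α.1 i = false

lemma height_sub_eq_gap (h : α ∈ flips β) {k : ℕ} (hk : k ≤ N) :
    height β k - height α k = 2 * (gap β α k : ℤ) :=
  height_sub_eq_count ((mem_flips_iff β α).1 h).1 hk

/-- Inside a flipped pairing the gap is larger than at its left end. -/
lemma Flipped.gap_lt {i j k : ℕ} (h : Flipped β α i j) (h1 : i < k) (h2 : k ≤ j) :
    gap β α i < gap β α k := by
  obtain ⟨s, hs⟩ := h.1.openSteps_append h1 h2
  rw [gap, gap, flags, flags, hs, List.map_append, List.map_cons, List.count_append, h.2,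
    List.count_cons_self]
  omega

lemma Flipped.gap_right {i j : ℕ} (h : Flipped β α i j) : gap β α (j + 1) = gap β α i := by
  rw [gap, gap, flags, flags, h.1.openSteps_succ]

/-- Two flipped pairings of the same depth over a common column agree. -/
lemma Flipped.unique {i j i' j' k : ℕ} (h : Flipped β α i j) (h' : Flipped β α i' j')
    (hg : gap β α i = gap β α i') (h1 : i < k) (h2 : k ≤ j) (h1' : i' < k) (h2' : k ≤ j') :
    i = i' ∧ j = j' := by
  rcases lt_trichotomy i i' with hlt | rfl | hlt
  · have := h.gap_lt hlt (by omega); omega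
  · exact ⟨rfl, h.1.right_unique h'.1⟩
  · have := h'.gap_lt hlt (by omega); omega

/-- In a flip, every step which is turned from up to down starts a flipped pairing. -/
lemma exists_flipped (h : α ∈ flips β) {i : ℕ} (hi : i < N) (hβ : letter β.1 i = true)
    (hα : letter α.1 i = false) : ∃ j, Flipped β α i j := by
  rcases mem_openSteps_or_paired β hβ hi le_rfl with h1 | ⟨j, -, hj⟩
  · have := ((mem_flips_iff β α).1 h).2 _ (List.mem_map_of_mem h1)
    rw [hα] at this; simp at this
  · exact ⟨j, hj, hα⟩

/-- A box at depth `r` of the region lies below a flipped pairing: the one starting at the last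
vertex to the left of the box at which the gap is at most `r`. -/
lemma exists_flipped_over (h : α ∈ flips β) {k r : ℕ} (hk : k ≤ N) (hr : r < gap β α k) :
    ∃ i j, Flipped β α i j ∧ gap β α i = r ∧ i < k ∧ k ≤ j := by
  have h0 : gap β α 0 ≤ r := by simp [gap, flags, openSteps]
  set i := Nat.findGreatest (fun i => gap β α i ≤ r) k with hi
  have hir : gap β α i ≤ r :=
    Nat.findGreatest_spec (P := fun i => gap β α i ≤ r) (Nat.zero_le k) h0
  have hik : i ≤ k := Nat.findGreatest_le k
  have hmax : ∀ l, i < l → l ≤ k → r < gap β α l := fun l h1 h2 =>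
    not_le.1 (Nat.findGreatest_is_greatest (P := fun i => gap β α i ≤ r) h1 h2)
  have hlt : i < k := by
    rcases hik.eq_or_lt with e | e
    · rw [e] at hir; omega
    · exact e
  have h1 := hmax (i + 1) (by omega) (by omega)
  have e0 := height_sub_eq_gap h (show i ≤ N by omega)
  have e1 := height_sub_eq_gap h (show i + 1 ≤ N by omega)
  have hβ := height_step β (show i < N by omega)
  have hα := height_step α (show i < N by omega)
  have hβ' : letter β.1 i = true := by
    rcases hβ with h2 | h2
    · exact h2.1
    · omega
  have hα' : letter α.1 i = false := by
    rcases hα with h2 | h2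
    · omega
    · exact h2.1
  obtain ⟨j, hj⟩ := exists_flipped h (by omega) hβ' hα'
  refine ⟨i, j, hj, by omega, hlt, ?_⟩
  by_contra hjk
  have h2 := hmax (j + 1) (by have := hj.1.1; omega) (by omega)
  rw [hj.gap_right] at h2
  omega

open Classical in
/-- The pairings of `β` which are flipped in `α`. -/
def flippedPairs (β α : Path N K) : Finset (ℕ × ℕ) :=
  (Finset.range N ×ˢ Finset.range N).filter fun p => Flipped β α p.1 p.2

lemma mem_flippedPairs {p : ℕ × ℕ} : p ∈ flippedPairs β α ↔ Flipped β α p.1 p.2 := by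
  classical
  rw [flippedPairs, Finset.mem_filter, Finset.mem_product, Finset.mem_range, Finset.mem_range]
  exact ⟨fun h => h.2, fun h => ⟨⟨h.1.1.trans h.1.2.1, h.1.2.1⟩, h⟩⟩

/-- The configuration of a flip: nested strips below the flipped pairings, the outer ones above
the inner ones. -/
def flipStrips (β α : Path N K) : Finset (Finset (ℤ × ℤ)) :=
  (flippedPairs β α).image fun p => stripAt β (gap β α p.1) p.1 p.2

lemma mem_flipStrips {D : Finset (ℤ × ℤ)} :
    D ∈ flipStrips β α ↔ ∃ i j, Flipped β α i j ∧ D = stripAt β (gap β α i) i j := by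
  rw [flipStrips, Finset.mem_image]
  constructor
  · rintro ⟨p, hp, rfl⟩
    exact ⟨p.1, p.2, mem_flippedPairs.1 hp, rfl⟩
  · rintro ⟨i, j, h, rfl⟩
    exact ⟨(i, j), mem_flippedPairs.2 h, rfl⟩

lemma isDyckStrip_stripAt {i j : ℕ} (h : Paired β i j) (r : ℕ) :
    IsDyckStrip (stripAt β r i j) := by
  have hij := h.1
  have hjN := h.2.1
  have h1 := height_succ_true β (k := i) (by omega) h.letter_left
  have h2 := height_succ_false β hjN h.letter_right
  have h3 := h.2.2.1
  obtain ⟨l, hl⟩ : ∃ l : ℕ, j = i + 1 + 2 * l := by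
    obtain ⟨a, ha⟩ := even_height_add β (k := i) (by omega)
    obtain ⟨b, hb⟩ := even_height_add β (k := j) (by omega)
    exact ⟨(j - i - 1) / 2, by omega⟩
  refine ⟨(i : ℤ) + 1, l, fun k => height β (i + 1 + k) - 2 * r - 1, ?_, ?_, ?_, ?_⟩
  · intro k hk
    simp only [← add_assoc]
    have := height_step β (show i + 1 + k < N by omega)
    omega
  · intro k hk
    have := h.2.2.2 (i + 1 + k) (by omega) (by omega)
    simp only [add_zero]
    omega
  · simp only [add_zero, ← hl]
    omega
  · ext c
    rw [mem_stripAt, Finset.mem_image]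
    constructor
    · rintro ⟨k, h1, h2, rfl⟩
      obtain ⟨k, rfl⟩ : ∃ k', k = i + 1 + k' := ⟨k - (i + 1), by omega⟩
      refine ⟨k, Finset.mem_range.2 (by omega), ?_⟩
      rw [box]; push_cast; rfl
    · rintro ⟨k, hk, rfl⟩
      rw [Finset.mem_range] at hk
      refine ⟨i + 1 + k, by omega, by omega, ?_⟩
      rw [box]; push_cast; rfl

/-- The upper neighbours of a box of depth `r` have depth `r` or `r - 1`, according to the steps of
`β` between the columns. Boxes of depth `r - 1` are given by their height, as `r` may be `0`. -/
lemma mem_upperNeighbors_box {k r : ℕ} (hk0 : 0 < k) (hkN : k < N) {u : ℤ × ℤ}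
    (hu : u ∈ upperNeighbors (box β k r)) :
    u = ((k : ℤ), height β k - 2 * r + 1) ∨
    (∃ k', k = k' + 1 ∧ letter β.1 k' = false ∧ u = box β k' r) ∨
    (∃ k', k = k' + 1 ∧ letter β.1 k' = true ∧ u = ((k' : ℤ), height β k' - 2 * r + 1)) ∨
    (letter β.1 k = true ∧ u = box β (k + 1) r) ∨
    (letter β.1 k = false ∧ u = (((k + 1 : ℕ) : ℤ), height β (k + 1) - 2 * r + 1)) := by
  simp only [upperNeighbors, box, Finset.mem_insert, Finset.mem_singleton] at hu
  rcases hu with rfl | rfl | rfl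
  · left; rw [Prod.mk.injEq]; exact ⟨rfl, by ring⟩
  · obtain ⟨k, rfl⟩ : ∃ k', k = k' + 1 := ⟨k - 1, by omega⟩
    rcases height_step β (show k < N by omega) with ⟨h1, h2⟩ | ⟨h1, h2⟩
    · right; right; left
      refine ⟨k, rfl, h1, ?_⟩
      rw [Prod.mk.injEq]; push_cast; exact ⟨by ring, by omega⟩
    · right; left
      refine ⟨k, rfl, h1, ?_⟩
      rw [box, Prod.mk.injEq]; push_cast; exact ⟨by ring, by omega⟩
  · rcases height_step β hkN with ⟨h1, h2⟩ | ⟨h1, h2⟩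
    · right; right; right; left
      refine ⟨h1, ?_⟩
      rw [box, Prod.mk.injEq]; push_cast; exact ⟨by ring, by omega⟩
    · right; right; right; right
      refine ⟨h1, ?_⟩
      rw [Prod.mk.injEq]; push_cast; exact ⟨rfl, by omega⟩

lemma box_succ_eq (k r : ℕ) : ((k : ℤ), height β k - 2 * (r + 1 : ℕ) + 1) = box β k r := by
  rw [box, Prod.mk.injEq]; push_cast; exact ⟨rfl, by ring⟩

lemma eq_box_iff {k k' r r' : ℕ} :
    box β k' r' = ((k : ℤ), height β k - 2 * r + 1) ↔ k' = k ∧ r = r' + 1 := by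
  rw [box, Prod.mk.injEq, Nat.cast_inj]
  constructor
  · rintro ⟨rfl, h⟩; exact ⟨rfl, by omega⟩
  · rintro ⟨rfl, rfl⟩; push_cast; exact ⟨rfl, by ring⟩

/-- If a strip of a flip meets a strip from above, then it belongs to the next larger flipped
pairing. -/
lemma Flipped.nested_of_upper {i j i' j' : ℕ} (h : Flipped β α i j) (h' : Flipped β α i' j')
    (hne : (i, j) ≠ (i', j')) {c c' : ℤ × ℤ} (hc : c ∈ stripAt β (gap β α i) i j)
    (hc' : c' ∈ stripAt β (gap β α i') i' j') (hcc : c' ∈ upperNeighbors c) :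
    gap β α i = gap β α i' + 1 ∧ i' < i ∧ j < j' := by
  obtain ⟨k, h1, h2, rfl⟩ := mem_stripAt.1 hc
  obtain ⟨k', h1', h2', rfl⟩ := mem_stripAt.1 hc'
  have hjN := h.1.2.1
  have hjN' := h'.1.2.1
  have same : ∀ l, i < l → l ≤ j → i' < l → l ≤ j' → gap β α i' ≠ gap β α i := by
    intro l a b c d e
    obtain ⟨rfl, rfl⟩ := h.unique h' e.symm a b c d
    exact hne rfl
  have below : ∀ l, i < l → l ≤ j → i' < l → l ≤ j' → gap β α i = gap β α i' + 1 →
      gap β α i = gap β α i' + 1 ∧ i' < i ∧ j < j' := by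
    intro l a b c d e
    have hlt : i' < i := by
      rcases lt_trichotomy i i' with hlt | rfl | hlt
      · have := h.gap_lt hlt (by omega); omega
      · omega
      · exact hlt
    exact ⟨e, hlt, h'.1.nested h.1 hlt (by omega)⟩
  rcases mem_upperNeighbors_box (by omega) (by omega) hcc with hu | ⟨l, rfl, hl, hu⟩ |
    ⟨l, rfl, hl, hu⟩ | ⟨hl, hu⟩ | ⟨hl, hu⟩
  · obtain ⟨rfl, e⟩ := eq_box_iff.1 hu
    exact below k' h1 h2 h1' h2' e
  · obtain ⟨rfl, e⟩ := box_inj.1 hu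
    have : k' ≠ i := by rintro rfl; rw [h.1.letter_left] at hl; simp at hl
    exact absurd e (same k' (by omega) (by omega) h1' h2')
  · obtain ⟨rfl, e⟩ := eq_box_iff.1 hu
    have : k' ≠ j' := by rintro rfl; rw [h'.1.letter_right] at hl; simp at hl
    exact below (k' + 1) h1 h2 (by omega) (by omega) e
  · obtain ⟨rfl, e⟩ := box_inj.1 hu
    have : k ≠ j := by rintro rfl; rw [h.1.letter_right] at hl; simp at hl
    exact absurd e (same (k + 1) (by omega) (by omega) h1' h2')
  · obtain ⟨rfl, e⟩ := eq_box_iff.1 hu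
    have : k ≠ i' := by rintro rfl; rw [h'.1.letter_left] at hl; simp at hl
    exact below k h1 h2 (by omega) (by omega) e

lemma isTiling_flipStrips (h : α ∈ flips β) : IsTiling α β (flipStrips β α) where
  isDyckStrip D hD := by
    obtain ⟨i, j, hij, rfl⟩ := mem_flipStrips.1 hD
    exact isDyckStrip_stripAt hij.1 _
  disjoint D hD D' hD' hne := by
    obtain ⟨i, j, hij, rfl⟩ := mem_flipStrips.1 hD
    obtain ⟨i', j', hij', rfl⟩ := mem_flipStrips.1 hD'
    rw [Finset.disjoint_left]
    intro c hc hc'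
    obtain ⟨k, h1, h2, rfl⟩ := mem_stripAt.1 hc
    obtain ⟨h1', h2', h3⟩ := box_mem_stripAt.1 hc'
    obtain ⟨rfl, rfl⟩ := hij.unique hij' h3 h1 h2 h1' h2'
    exact hne rfl
  biUnion := by
    ext c
    rw [Finset.mem_biUnion, mem_region_iff]
    constructor
    · rintro ⟨D, hD, hc⟩
      obtain ⟨i, j, hij, rfl⟩ := mem_flipStrips.1 hD
      obtain ⟨k, h1, h2, rfl⟩ := mem_stripAt.1 hc
      have := hij.1.2.1
      have h3 := height_sub_eq_gap h (show k ≤ N by omega)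
      have h4 := hij.gap_lt h1 h2
      exact ⟨k, _, by omega, rfl, by omega⟩
    · rintro ⟨k, r, hk, rfl, hr⟩
      have h3 := height_sub_eq_gap h hk
      obtain ⟨i, j, hij, rfl, h1, h2⟩ := exists_flipped_over h (k := k) (r := r) hk (by omega)
      exact ⟨_, mem_flipStrips.2 ⟨i, j, hij, rfl⟩, box_mem_stripAt.2 ⟨h1, h2, rfl⟩⟩
  rule D hD D' hD' hne := by
    obtain ⟨i, j, hij, rfl⟩ := mem_flipStrips.1 hD
    obtain ⟨i', j', hij', rfl⟩ := mem_flipStrips.1 hD'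
    rintro ⟨c, hc, c', hc', hcc⟩
    obtain ⟨hg, hi, hj⟩ := hij.nested_of_upper hij'
      (fun e => hne (by rw [Prod.mk.injEq] at e; rw [e.1, e.2])) hc hc' hcc
    intro c hc u hu
    obtain ⟨k, h1, h2, rfl⟩ := mem_stripAt.1 hc
    have hjN := hij.1.2.1
    rw [Finset.mem_union]
    rcases mem_upperNeighbors_box (by omega) (by omega) hu with rfl | ⟨l, rfl, hl, rfl⟩ |
      ⟨l, rfl, hl, rfl⟩ | ⟨hl, rfl⟩ | ⟨hl, rfl⟩
    · rw [hg, box_succ_eq]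
      exact Or.inr (box_mem_stripAt.2 ⟨by omega, by omega, rfl⟩)
    · have : l ≠ i := by rintro rfl; rw [hij.1.letter_left] at hl; simp at hl
      exact Or.inl (box_mem_stripAt.2 ⟨by omega, by omega, rfl⟩)
    · rw [hg, box_succ_eq]
      exact Or.inr (box_mem_stripAt.2 ⟨by omega, by omega, rfl⟩)
    · have : k ≠ j := by rintro rfl; rw [hij.1.letter_right] at hl; simp at hl
      exact Or.inl (box_mem_stripAt.2 ⟨by omega, by omega, rfl⟩)
    · rw [hg, box_succ_eq]
      exact Or.inr (box_mem_stripAt.2 ⟨by omega, by omega, rfl⟩)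

/-- The configuration of a flip is the only one. -/
lemma IsTiling.eq_flipStrips {𝒟 : Finset (Finset (ℤ × ℤ))} (h : IsTiling α β 𝒟)
    (hle : PathLE α β) : 𝒟 = flipStrips β α := by
  have hf := h.mem_flips hle
  have hdepth : ∀ r i j, Paired β i j → stripAt β r i j ∈ 𝒟 → r = gap β α i := by
    intro r i j hij hD
    have hij1 := hij.1
    have hij2 := hij.2.1
    have h1 := h.depth_eq hij hD
    have h2 := height_succ_true β (k := i) (by omega) hij.letter_left
    have h3 := height_succ_false α (k := i) (by omega) (h.letter_left hij hD)
    have h4 := height_sub_eq_gap hf (k := i) (by omega)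
    omega
  ext D
  rw [mem_flipStrips]
  constructor
  · intro hD
    -- a strip is nonempty, so that it contains a box of the region
    obtain ⟨c, hc⟩ : D.Nonempty := by
      obtain ⟨x, l, p, -, -, -, rfl⟩ := h.isDyckStrip D hD
      exact Finset.Nonempty.image ⟨0, by simp⟩ _
    obtain ⟨k, r, -, rfl, -⟩ := (mem_region_iff _ _ _).1 (h.subset_region hD hc)
    obtain ⟨i, j, hij, rfl, -⟩ := h.shape r hD hc
    exact ⟨i, j, ⟨hij, h.letter_left hij hD⟩, by rw [← hdepth r i j hij hD]⟩
  · rintro ⟨i, j, hij, rfl⟩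
    obtain ⟨j', r, hij', hD⟩ := h.exists_right hle (hij.1.1.trans hij.1.2.1) hij.1.letter_left hij.2
    rw [hij.1.right_unique hij', ← hdepth r i j' hij' hD]
    exact hD

lemma card_flipStrips (h : α ∈ flips β) : (flipStrips β α).card = dist α β := by
  rw [flipStrips, Finset.card_image_of_injOn, dist_eq_card, card_filter_eq]
  · refine Finset.card_bij
      (fun p hp => ⟨p.1, (mem_flippedPairs.1 hp).1.1.trans (mem_flippedPairs.1 hp).1.2.1⟩) ?_ ?_ ?_
    · intro p hp
      have hp := mem_flippedPairs.1 hp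
      rw [Finset.mem_filter, ← letter_val β.1, ← letter_val α.1]
      exact ⟨Finset.mem_univ _, hp.1.letter_left, hp.2⟩
    · intro p hp q hq e
      have e : p.1 = q.1 := congrArg Fin.val e
      have hp := mem_flippedPairs.1 hp
      have hq := mem_flippedPairs.1 hq
      rw [← e] at hq
      exact Prod.ext e (hp.1.right_unique hq.1)
    · intro i hi
      rw [Finset.mem_filter, ← letter_val β.1, ← letter_val α.1] at hi
      obtain ⟨j, hj⟩ := exists_flipped h i.2 hi.2.1 hi.2.2
      exact ⟨(i, j), mem_flippedPairs.2 hj, rfl⟩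
  · intro p hp q hq e
    have hp := mem_flippedPairs.1 hp
    have hq := mem_flippedPairs.1 hq
    have hp1 := hp.1.1
    have hm : box β (p.1 + 1) (gap β α p.1) ∈ stripAt β (gap β α q.1) q.1 q.2 := by
      have e : stripAt β (gap β α p.1) p.1 p.2 = stripAt β (gap β α q.1) q.1 q.2 := e
      rw [← e]
      exact box_mem_stripAt.2 ⟨by omega, by omega, rfl⟩
    obtain ⟨h1, h2, h3⟩ := box_mem_stripAt.1 hm
    have := hp.unique hq h3 (Nat.lt_succ_self _) hp1 h1 h2
    exact Prod.ext this.1 this.2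

open Classical in
lemma QII_eq (α β : Path N K) :
    QII α β = if α ∈ flips β then T (-(dist α β : ℤ)) else 0 := by
  rw [QII]
  split_ifs with h1 h2 h3 h4 h5
  · rw [h1, ParabolicKL.dist]; simp
  · rw [h1] at h2; exact absurd (self_mem_flips β) h2
  · have : ConfII α β = {flipStrips β α} := by
      ext 𝒟
      rw [mem_confII, Finset.mem_singleton]
      exact ⟨fun h => h.eq_flipStrips h3, fun h => h ▸ isTiling_flipStrips h4⟩
    rw [this, Finset.sum_singleton, card_flipStrips h4]
  · have : ConfII α β = ∅ := by
      rw [Finset.eq_empty_iff_forall_notMem]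
      intro 𝒟 h
      exact h4 (((mem_confII _ _ _).1 h).mem_flips h3)
    rw [this, Finset.sum_empty]
  · exact absurd h5.1 h3
  · rfl

end ParabolicKL

end

theorem mainTheorem2 (N K : ℕ) (hN : 0 < N) (hK : K ≤ N) :
    (∃! b : ParabolicKL.M N K → ParabolicKL.M N K, ParabolicKL.IsBarInvolution b) ∧
    ∀ b : ParabolicKL.M N K → ParabolicKL.M N K, ParabolicKL.IsBarInvolution b →
      (∃! C : Module.Basis (ParabolicKL.Coset N K) ParabolicKL.R (ParabolicKL.M N K),
        ParabolicKL.IsKLBasis b C) ∧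
      ∀ C : Module.Basis (ParabolicKL.Coset N K) ParabolicKL.R (ParabolicKL.M N K),
        ParabolicKL.IsKLBasis b C → ∀ α β : ParabolicKL.Path N K,
          ParabolicKL.klPoly hK C α β = ParabolicKL.QII α β ∧
          (α ∈ ParabolicKL.flips β →
            ParabolicKL.klPoly hK C α β =
              LaurentPolynomial.T (-(ParabolicKL.dist α β : ℤ))) ∧
          (α ∉ ParabolicKL.flips β → ParabolicKL.klPoly hK C α β = 0) := by
  have hu := ParabolicKL.existsUnique_isBarInvolution (K := K) hN hK
  refine ⟨hu, fun b hb => ?_⟩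
  obtain rfl := hu.unique hb (ParabolicKL.isBarInvolution_barM hK)
  refine ⟨⟨ParabolicKL.klBasis hK, ParabolicKL.isKLBasis_klBasis hK,
    fun C hC => hC.eq_klBasis hK⟩, fun C hC α β => ?_⟩
  rw [hC.eq_klBasis hK, ParabolicKL.klPoly_klBasis, ParabolicKL.QII_eq]
  exact ⟨rfl, fun h => if_pos h, fun h => if_neg h⟩
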